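/- Let $d\ge 1$ and let $\pi=(\pi_1,\dots,\pi_n)$ be a $d$-dimensional, $n$-outcome quantum measurement, i.e. $d\times d$ complex matrices $\pi_i\ge 0$ with $\sum_i\pi_i=\mathbb 1$, and for a Hermitian matrix $X$ put $\pi(X)=(\operatorname{Tr}[\pi_1X],\dots,\operatorname{Tr}[\pi_nX])\in\mathbb R^n$. Let $\mathbb S_d$ be the set of density matrices ($\rho\ge0$, $\operatorname{Tr}\rho=1$), and call $\pi(\mathbb S_d)$ the testing region of $\pi$. Assume that $\pi$ is informationally complete, i.e. $\rho\mapsto\pi(\rho)$ is injective on $\mathbb S_d$. Define $t\in\mathbb R^n$ and $Q\in\mathbb R^{n\times n}$ by $$t_i=\frac1d\operatorname{Tr}[\pi_i],\qquad Q_{ij}=\frac{d-1}{d}\Big(\operatorname{Tr}[\pi_i\pi_j]-\frac{\operatorname{Tr}[\pi_i]\operatorname{Tr}[\pi_j]}{d}\Big),$$ let $Q^+$ be the Moore–Penrose pseudo-inverse of $Q$, and for $r\in\mathbb R$ let $$\mathcal E_r(\pi)=\Big\{p\in\mathbb R^n:\ p=\pi(X)\text{ for some Hermitian }X\text{ with }\operatorname{Tr}X=1,\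 \ \big\|\sqrt{Q^+}\,(p-t)\big\|_2^2\le \frac1{r^2}\Big\}.$$ (Only $r=1$ and $r=d-1$ are used; for $d=1$ the set $\mathcal E_{0}(\pi)$ is the single point $t$ whatever nonnegative value is given to $1/0^2$.) Then $\mathcal E_{d-1}(\pi)$ is the unique ellipsoid of maximum volume contained in $\pi(\mathbb S_d)$, and $\mathcal E_1(\pi)$ is the unique ellipsoid of minimum volume containing $\pi(\mathbb S_d)$. Here "ellipsoid" means a nondegenerate solid ellipsoid of dimension $d^2-1$ in $\mathbb R^n$ (the image of the closed unit ball of $\mathbb R^{d^2-1}$ under an injective affine map), $d^2-1$ being the dimension of the affine hull of the testing region, and volume is $(d^2-1)$-dimensional volume. -/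

import Mathlib

open scoped MeasureTheory ComplexOrder

noncomputable section

/-- The Moore–Penrose pseudo-inverse of a real symmetric matrix `A`: in an orthonormal eigenbasis,
every nonzero eigenvalue `x` is replaced by `x⁻¹` and the eigenvalue `0` is kept
(this is the convention `0⁻¹ = 0`). -/
def symmPinv {n : ℕ} (A : Matrix (Fin n) (Fin n) ℝ) : Matrix (Fin n) (Fin n) ℝ :=
  cfc (fun x : ℝ => x⁻¹) A

/-- The square root of a real positive semidefinite matrix, through its spectral decomposition. -/
def psdSqrt {n : ℕ} (A : Matrix (Fin n) (Fin n) ℝ) : Matrix (Fin n) (Fin n) ℝ :=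
  cfc Real.sqrt A

/-- The four Penrose equations, which characterize the pseudo-inverse. -/
theorem symmPinv_penrose {n : ℕ} {A : Matrix (Fin n) (Fin n) ℝ} (hA : A.IsHermitian) :
    A * symmPinv A * A = A ∧ symmPinv A * A * symmPinv A = symmPinv A ∧
      (symmPinv A * A).IsHermitian ∧ (A * symmPinv A).IsHermitian := by
  have hA' : IsSelfAdjoint A := hA
  have hc : ∀ f : ℝ → ℝ, ContinuousOn f (spectrum ℝ A) := fun f =>
    (Matrix.finite_real_spectrum (A := A)).continuousOn f
  have h1 : A * symmPinv A = cfc (fun x : ℝ => x * x⁻¹) A := by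
    rw [cfc_mul (fun x : ℝ => x) (fun x : ℝ => x⁻¹) A (hc _) (hc _), cfc_id' ℝ A, symmPinv]
  have h2 : symmPinv A * A = cfc (fun x : ℝ => x⁻¹ * x) A := by
    rw [cfc_mul (fun x : ℝ => x⁻¹) (fun x : ℝ => x) A (hc _) (hc _), cfc_id' ℝ A, symmPinv]
  refine ⟨?_, ?_, ?_, ?_⟩
  · rw [h1]
    nth_rewrite 2 [← cfc_id' ℝ A]
    rw [← cfc_mul (fun x : ℝ => x * x⁻¹) (fun x : ℝ => x) A (hc _) (hc _)]
    simp only [mul_inv_mul_cancel]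
    exact cfc_id' ℝ A
  · rw [h2, symmPinv, ← cfc_mul (fun x : ℝ => x⁻¹ * x) (fun x : ℝ => x⁻¹) A (hc _) (hc _)]
    congr 1
    funext x
    by_cases hx : x = 0 <;> simp [hx]
  · rw [h2]; exact cfc_predicate _ A
  · rw [h1]; exact cfc_predicate _ A

/-- The set of density matrices (quantum states) of dimension `d`. -/
def quantumStates (d : ℕ) : Set (Matrix (Fin d) (Fin d) ℂ) :=
  {ρ | ρ.PosSemidef ∧ ρ.trace = 1}

/-- A `d`-dimensional, `n`-outcome quantum measurement (POVM). -/
structure QMeasurement (d n : ℕ) where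
  effect : Fin n → Matrix (Fin d) (Fin d) ℂ
  posSemidef : ∀ i, (effect i).PosSemidef
  sum_eq_one : ∑ i, effect i = 1

namespace QMeasurement

variable {d n : ℕ}

/-- The action `X ↦ (Tr[π₁ X], …, Tr[πₙ X])` of a measurement on operators
(the traces are real whenever `X` is Hermitian). -/
def apply (M : QMeasurement d n) (X : Matrix (Fin d) (Fin d) ℂ) : EuclideanSpace ℝ (Fin n) :=
  WithLp.toLp 2 fun i => ((M.effect i * X).trace).re

/-- The testing region: the set of all outcome distributions of quantum states. -/
def testingRegion (M : QMeasurement d n) : Set (EuclideanSpace ℝ (Fin n)) :=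
  M.apply '' quantumStates d

/-- A measurement is informationally complete if its outcome distribution determines the state. -/
def InformationallyComplete (M : QMeasurement d n) : Prop :=
  Set.InjOn M.apply (quantumStates d)

/-- The covariance matrix `Q`. -/
def covariance (M : QMeasurement d n) : Matrix (Fin n) (Fin n) ℝ :=
  Matrix.of fun i j => ((d : ℝ) - 1) / d *
    (((M.effect i * M.effect j).trace).re
      - ((M.effect i).trace).re * ((M.effect j).trace).re / d)

/-- The vector `t` with `tᵢ = Tr[πᵢ] / d`. -/
def center (M : QMeasurement d n) : EuclideanSpace ℝ (Fin n) :=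
  WithLp.toLp 2 fun i => ((M.effect i).trace).re / d

/-- The ellipsoid `E_r`: the points `p` of the image of the unit-trace Hermitian operators
(the affine hull of the testing region) with `|√Q⁺ (p - t)|² ≤ 1 / r²`. -/
def ellipsoid (M : QMeasurement d n) (r : ℝ) : Set (EuclideanSpace ℝ (Fin n)) :=
  {p | p ∈ M.apply '' {X | X.IsHermitian ∧ X.trace = 1} ∧
    ‖Matrix.toEuclideanLin (psdSqrt (symmPinv M.covariance)) (p - M.center)‖ ^ 2 ≤ 1 / r ^ 2}

end QMeasurement

/-- A nondegenerate `k`-dimensional (solid) ellipsoid in `ℝⁿ`: the image of the closed unit ball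
of `ℝᵏ` under an injective affine map. -/
def IsEllipsoid {n : ℕ} (k : ℕ) (E : Set (EuclideanSpace ℝ (Fin n))) : Prop :=
  ∃ f : EuclideanSpace ℝ (Fin k) →ᵃ[ℝ] EuclideanSpace ℝ (Fin n),
    Function.Injective f ∧ E = f '' Metric.closedBall 0 1

/-- `E` is the unique `k`-dimensional ellipsoid of maximum `k`-dimensional volume among those
contained in `K`. -/
def IsMaxVolumeEllipsoidIn {n : ℕ} (k : ℕ) (E K : Set (EuclideanSpace ℝ (Fin n))) : Prop :=
  IsEllipsoid k E ∧ E ⊆ K ∧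
    ∀ F, IsEllipsoid k F → F ⊆ K → μHE[k] F ≤ μHE[k] E ∧ (μHE[k] F = μHE[k] E → F = E)

/-- `E` is the unique `k`-dimensional ellipsoid of minimum `k`-dimensional volume among those
containing `K`. -/
def IsMinVolumeEllipsoidOver {n : ℕ} (k : ℕ) (E K : Set (EuclideanSpace ℝ (Fin n))) : Prop :=
  IsEllipsoid k E ∧ K ⊆ E ∧
    ∀ F, IsEllipsoid k F → K ⊆ F → μHE[k] E ≤ μHE[k] F ∧ (μHE[k] F = μHE[k] E → F = E)

end

/-! Everything is pulled back to the state space. With Hilbert–Schmidt orthonormal coordinates `x`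
on traceless Hermitian matrices, ρ = 1/d + J x, and for d ≥ 2 informational completeness makes x ↦
π(1/d + J x) an injective affine map. Such a map multiplies all volumes by one constant and carries
ellipsoids to ellipsoids, so only the body of states matters.

Put R = √((d-1)/d) and r = R/(d-1), so that rR = 1/d. The bound Tr ρ² ≤ 1 puts the states inside the
ball of radius R (`chartStates_subset_closedBall`), and Cauchy–Schwarz shows that they contain the
ball of radius r (`closedBall_subset_chartStates`). Both balls are extremal by John's criterion: the
pure states of a weighted 2-design give vectors v_i of norm R with Σ c_i v_i = 0 and Σ c_i v_i v_iᵀ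
= 1 (`exists_chart_design`). They lie on the outer sphere, and positivity of Tr[P_i ρ] confines the
states to the half-spaces ⟨v_i, x⟩ ≥ -rR, which support the inner ball. Averaging over the design
bounds a trace, the volume assumption bounds a determinant, and equality in AM–GM forces a ball
(`eq_scalar_of_inscribed`, `eq_scalar_of_circumscribed`).

Finally Q = R² A Aᵀ, where A is the matrix of the linear part of the pulled-back map, so √Q⁺ (p - t)
has norm ‖x‖ / R and the two balls are carried to E_{d-1} and E_1. -/

noncomputable section

open Matrix

/-! ### Equality in AM–GM, matrix square roots and polar decomposition -/

theorem Matrix.PosSemidef.eq_one_of_trace_le_of_one_le_det {m : Type*} [Fintype m] [DecidableEq m]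
    {P : Matrix m m ℝ} (hP : P.PosSemidef) (htr : P.trace ≤ Fintype.card m) (hdet : 1 ≤ P.det) :
    P = 1 := by
  have hH := hP.isHermitian
  have h0 : ∀ i, 0 ≤ hH.eigenvalues i := hP.eigenvalues_nonneg
  have htr' : ∑ i, hH.eigenvalues i ≤ Fintype.card m := by
    have := hH.trace_eq_sum_eigenvalues
    simp only [RCLike.ofReal_real_eq_id, id] at this
    rwa [← this]
  have hdet' : 1 ≤ ∏ i, hH.eigenvalues i := by
    have := hH.det_eq_prod_eigenvalues
    simp only [RCLike.ofReal_real_eq_id, id] at this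
    rwa [← this]
  have hne : ∀ i, hH.eigenvalues i ≠ 0 := fun i hi => by
    rw [Finset.prod_eq_zero (Finset.mem_univ i) hi] at hdet'
    linarith
  have hpos : ∀ i, 0 < hH.eigenvalues i := fun i => lt_of_le_of_ne (h0 i) (hne i).symm
  have hlog : 0 ≤ ∑ i, Real.log (hH.eigenvalues i) := by
    rw [← Real.log_prod (fun i _ => hne i)]
    exact Real.log_nonneg hdet'
  have hterm : ∀ i ∈ Finset.univ,
      0 ≤ hH.eigenvalues i - 1 - Real.log (hH.eigenvalues i) := fun i _ => by
    linarith [Real.log_le_sub_one_of_pos (hpos i)]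
  -- The terms x - 1 - log x are nonnegative, while the trace and determinant bounds make their sum
  -- nonpositive; x = 1 is the only zero.
  have hsum : ∑ i, (hH.eigenvalues i - 1 - Real.log (hH.eigenvalues i)) = 0 := by
    apply le_antisymm _ (Finset.sum_nonneg hterm)
    rw [Finset.sum_sub_distrib, Finset.sum_sub_distrib]
    simp only [Finset.sum_const, Finset.card_univ, nsmul_eq_mul, mul_one]
    linarith
  have hone : hH.eigenvalues = fun _ => 1 := by
    funext i
    have h := (Finset.sum_eq_zero_iff_of_nonneg hterm).1 hsum i (Finset.mem_univ i)
    by_contra hi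
    linarith [Real.log_lt_sub_one_of_pos (hpos i) hi]
  rw [hH.spectral_theorem, hone]
  have : diagonal ((RCLike.ofReal : ℝ → ℝ) ∘ fun _ : m => (1 : ℝ)) = 1 := by
    ext i j; simp [diagonal, one_apply]
  rw [this, map_one]

theorem spectrum_nonneg_of_posSemidef {k : ℕ} {A : Matrix (Fin k) (Fin k) ℝ} (hA : A.PosSemidef) :
    ∀ x ∈ spectrum ℝ A, 0 ≤ x := by
  intro x hx
  rw [hA.isHermitian.spectrum_real_eq_range_eigenvalues] at hx
  obtain ⟨i, rfl⟩ := hx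
  exact hA.eigenvalues_nonneg i

theorem continuousOn_spectrum {k : ℕ} (A : Matrix (Fin k) (Fin k) ℝ) (f : ℝ → ℝ) :
    ContinuousOn f (spectrum ℝ A) :=
  (Matrix.finite_real_spectrum (A := A)).continuousOn f

theorem psdSqrt_isHermitian {k : ℕ} (A : Matrix (Fin k) (Fin k) ℝ) : (psdSqrt A).IsHermitian :=
  cfc_predicate _ A

theorem psdSqrt_mul_self {k : ℕ} {A : Matrix (Fin k) (Fin k) ℝ} (hA : A.PosSemidef) :
    psdSqrt A * psdSqrt A = A := by
  have hA' : IsSelfAdjoint A := hA.isHermitian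
  rw [psdSqrt, ← cfc_mul _ _ A (continuousOn_spectrum _ _) (continuousOn_spectrum _ _)]
  conv_rhs => rw [← cfc_id' ℝ A]
  exact cfc_congr fun x hx => Real.mul_self_sqrt (spectrum_nonneg_of_posSemidef hA x hx)

theorem psdSqrt_posSemidef {k : ℕ} (A : Matrix (Fin k) (Fin k) ℝ) : (psdSqrt A).PosSemidef := by
  by_cases hA' : IsSelfAdjoint A
  · have : psdSqrt A = (cfc (fun x => √√x) A)ᴴ * cfc (fun x => √√x) A := by
      have h : (cfc (fun x => √√x) A)ᴴ = cfc (fun x => √√x) A :=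
        (cfc_predicate (fun x => √√x) A : IsSelfAdjoint _)
      rw [h, ← cfc_mul _ _ A (continuousOn_spectrum _ _) (continuousOn_spectrum _ _)]
      exact cfc_congr fun x _ => (Real.mul_self_sqrt (Real.sqrt_nonneg x)).symm
    rw [this]
    exact posSemidef_conjTranspose_mul_self _
  · rw [psdSqrt, cfc_apply_of_not_predicate _ hA']
    exact PosSemidef.zero

/-- Polar decomposition with U = G⁻¹√(G Gᵀ). As U preserves the unit ball, G and G * U define the
same ellipsoid. -/
theorem exists_orthogonal_mul_posSemidef {k : ℕ} (G : Matrix (Fin k) (Fin k) ℝ) (hG : G.det ≠ 0) :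
    ∃ U : Matrix (Fin k) (Fin k) ℝ, Uᵀ * U = 1 ∧ (G * U).PosSemidef := by
  have hA : (G * Gᵀ).PosSemidef := by
    simpa using posSemidef_self_mul_conjTranspose G
  have hu : IsUnit G.det := hG.isUnit
  have hut : IsUnit Gᵀ.det := by rwa [det_transpose]
  have hs : (psdSqrt (G * Gᵀ))ᵀ = psdSqrt (G * Gᵀ) := by
    simpa [IsHermitian] using psdSqrt_isHermitian (G * Gᵀ)
  refine ⟨G⁻¹ * psdSqrt (G * Gᵀ), ?_, ?_⟩
  · have : G⁻¹ * psdSqrt (G * Gᵀ) * (G⁻¹ * psdSqrt (G * Gᵀ))ᵀ = 1 := by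
      rw [transpose_mul, hs, Matrix.mul_assoc, ← Matrix.mul_assoc (psdSqrt _),
        psdSqrt_mul_self hA, transpose_nonsing_inv, ← Matrix.mul_assoc, ← Matrix.mul_assoc,
        nonsing_inv_mul _ hu, Matrix.one_mul, mul_nonsing_inv _ hut]
    exact mul_eq_one_comm.1 this
  · rw [mul_nonsing_inv_cancel_left _ _ hu]
    exact psdSqrt_posSemidef _

/-! ### John's argument in matrix form -/

section Design

variable {ι : Type*} [Fintype ι] {k : ℕ} {c : ι → ℝ} {v : ι → Fin k → ℝ}

/-- Turns inequalities at the individual contact vectors into a bound on a trace. -/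
theorem sum_dotProduct_mulVec_eq_trace
    (h2 : ∀ p q, ∑ i, c i * (v i p * v i q) = (1 : Matrix (Fin k) (Fin k) ℝ) p q)
    (T : Matrix (Fin k) (Fin k) ℝ) : ∑ i, c i * (v i ⬝ᵥ T *ᵥ v i) = T.trace := by
  calc ∑ i, c i * (v i ⬝ᵥ T *ᵥ v i)
      = ∑ i, ∑ p, ∑ q, T p q * (c i * (v i p * v i q)) := by
        refine Finset.sum_congr rfl fun i _ => ?_
        simp only [dotProduct, mulVec, Finset.mul_sum]
        exact Finset.sum_congr rfl fun p _ => Finset.sum_congr rfl fun q _ => by ring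
    _ = ∑ p, ∑ q, T p q * ∑ i, c i * (v i p * v i q) := by
        rw [Finset.sum_comm]
        refine Finset.sum_congr rfl fun p _ => ?_
        rw [Finset.sum_comm]
        simp only [Finset.mul_sum]
    _ = T.trace := by simp [h2, one_apply, trace]

theorem sum_mul_dotProduct_eq_zero (h1 : ∀ p, ∑ i, c i * v i p = 0) (a : Fin k → ℝ) :
    ∑ i, c i * (v i ⬝ᵥ a) = 0 := by
  calc ∑ i, c i * (v i ⬝ᵥ a) = ∑ p, a p * ∑ i, c i * v i p := by
        simp only [dotProduct, Finset.mul_sum]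
        rw [Finset.sum_comm]
        exact Finset.sum_congr rfl fun p _ => Finset.sum_congr rfl fun q _ => by ring
    _ = 0 := by simp [h1]

theorem sum_mul_dotProduct_sq
    (h2 : ∀ p q, ∑ i, c i * (v i p * v i q) = (1 : Matrix (Fin k) (Fin k) ℝ) p q)
    (a : Fin k → ℝ) : ∑ i, c i * (v i ⬝ᵥ a) ^ 2 = a ⬝ᵥ a := by
  have h := sum_dotProduct_mulVec_eq_trace h2 (vecMulVec a a)
  rw [trace_vecMulVec] at h
  rw [← h]
  refine Finset.sum_congr rfl fun i _ => ?_
  rw [vecMulVec_mulVec, dotProduct_smul, dotProduct_comm a (v i)]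
  simp [sq]

/-- John's argument for inscribed ellipsoids. -/
theorem eq_scalar_of_inscribed {R r : ℝ} (hR : 0 < R) (hr : 0 < r) (hc : ∀ i, 0 ≤ c i)
    (h1 : ∀ p, ∑ i, c i * v i p = 0)
    (h2 : ∀ p q, ∑ i, c i * (v i p * v i q) = (1 : Matrix (Fin k) (Fin k) ℝ) p q)
    (hv : ∀ i, v i ⬝ᵥ v i = R ^ 2) (G : Matrix (Fin k) (Fin k) ℝ) (a : Fin k → ℝ)
    (hG : G.det ≠ 0)
    (hin : ∀ i y, y ⬝ᵥ y ≤ 1 → -(r * R) ≤ v i ⬝ᵥ (a + G *ᵥ y))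
    (hdet : r ^ k ≤ |G.det|) :
    a = 0 ∧ G * Gᵀ = r ^ 2 • 1 := by
  obtain ⟨U, hU, hP⟩ := exists_orthogonal_mul_posSemidef G hG
  have key : ∀ i, v i ⬝ᵥ (G * U) *ᵥ v i ≤ r * R ^ 2 + R * (v i ⬝ᵥ a) := fun i => by
    -- This unit vector is sent by G to -R⁻¹ (G * U) v_i, which produces the quadratic form of the
    -- positive semidefinite factor.
    have h := hin i (-(R⁻¹ • U *ᵥ v i)) (by
      rw [neg_dotProduct_neg, smul_dotProduct, dotProduct_smul, dotProduct_mulVec, vecMul_mulVec,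
        ← dotProduct_mulVec, hU, one_mulVec, hv]
      simp only [smul_eq_mul]
      apply le_of_eq
      field_simp)
    rw [mulVec_neg, mulVec_smul, mulVec_mulVec, dotProduct_add, dotProduct_neg,
      dotProduct_smul, smul_eq_mul] at h
    have h' : R⁻¹ * (v i ⬝ᵥ (G * U) *ᵥ v i) ≤ r * R + v i ⬝ᵥ a := by linarith
    rw [inv_mul_le_iff₀ hR] at h'
    linarith
  have hcR : (∑ i, c i) * R ^ 2 = k := by
    have h := sum_dotProduct_mulVec_eq_trace h2 1
    simp only [one_mulVec, hv, trace_one, Fintype.card_fin] at h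
    rw [Finset.sum_mul, h]
  have htr : (G * U).trace ≤ r * k := by
    rw [← sum_dotProduct_mulVec_eq_trace h2]
    calc _ ≤ ∑ i, c i * (r * R ^ 2 + R * (v i ⬝ᵥ a)) :=
          Finset.sum_le_sum fun i _ => mul_le_mul_of_nonneg_left (key i) (hc i)
      _ = r * ((∑ i, c i) * R ^ 2) + R * ∑ i, c i * (v i ⬝ᵥ a) := by
          rw [Finset.sum_mul, Finset.mul_sum, Finset.mul_sum, ← Finset.sum_add_distrib]
          exact Finset.sum_congr rfl fun i _ => by ring
      _ = r * k := by rw [sum_mul_dotProduct_eq_zero h1, hcR]; ring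
  have hdU : |U.det| = 1 := by
    have := congrArg det hU
    rw [det_mul, det_transpose, det_one] at this
    rcases mul_self_eq_one_iff.1 this with h | h <;> simp [h]
  have hdGU : r ^ k ≤ (G * U).det := by
    rw [← abs_of_nonneg hP.det_nonneg, det_mul, abs_mul, hdU, mul_one]
    exact hdet
  have hone : r⁻¹ • (G * U) = 1 := by
    refine (hP.smul (inv_nonneg.2 hr.le)).eq_one_of_trace_le_of_one_le_det ?_ ?_
    · rw [trace_smul, smul_eq_mul, inv_mul_le_iff₀ hr]
      simpa using htr
    · rw [det_smul, Fintype.card_fin, inv_pow, le_inv_mul_iff₀ (pow_pos hr k), mul_one]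
      exact hdGU
  have hGU : G * U = r • 1 := by rw [← hone, smul_smul, mul_inv_cancel₀ hr.ne', one_smul]
  have hG' : G = r • Uᵀ := by
    rw [← Matrix.mul_one G, ← mul_eq_one_comm.1 hU, ← Matrix.mul_assoc, hGU, Matrix.smul_mul,
      Matrix.one_mul]
  refine ⟨?_, by rw [hG', transpose_smul, transpose_transpose, Matrix.smul_mul, Matrix.mul_smul,
    hU, smul_smul, sq]⟩
  -- Once G * U = r • 1, `key` leaves only ⟨v_i, a⟩ ≥ 0. The weighted sum of these is zero, so every
  -- weighted term vanishes, and so does |a|².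
  have hnn : ∀ i, 0 ≤ v i ⬝ᵥ a := fun i => by
    have h := key i
    rw [hGU, smul_mulVec, one_mulVec, dotProduct_smul, hv, smul_eq_mul] at h
    exact nonneg_of_mul_nonneg_right (by linarith) hR
  have hz := (Finset.sum_eq_zero_iff_of_nonneg fun i _ => mul_nonneg (hc i) (hnn i)).1
    (sum_mul_dotProduct_eq_zero h1 a)
  have haa : a ⬝ᵥ a = 0 := by
    rw [← sum_mul_dotProduct_sq h2]
    refine Finset.sum_eq_zero fun i hi => ?_
    rw [sq, ← mul_assoc, hz i hi, zero_mul]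
  exact dotProduct_self_eq_zero.1 haa

/-- John's argument for circumscribed ellipsoids. -/
theorem eq_scalar_of_circumscribed {R : ℝ} (hR : 0 < R) (hc : ∀ i, 0 ≤ c i)
    (hcpos : 0 < ∑ i, c i)
    (h1 : ∀ p, ∑ i, c i * v i p = 0)
    (h2 : ∀ p q, ∑ i, c i * (v i p * v i q) = (1 : Matrix (Fin k) (Fin k) ℝ) p q)
    (hv : ∀ i, v i ⬝ᵥ v i = R ^ 2) (G : Matrix (Fin k) (Fin k) ℝ) (a : Fin k → ℝ)
    (hG : G.det ≠ 0)
    (hout : ∀ i, ∃ y, y ⬝ᵥ y ≤ 1 ∧ v i = a + G *ᵥ y)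
    (hdet : |G.det| ≤ R ^ k) :
    a = 0 ∧ G * Gᵀ = R ^ 2 • 1 := by
  have hu : IsUnit G.det := hG.isUnit
  set H := G⁻¹ with hH
  have hdot : ∀ x y, (H *ᵥ x) ⬝ᵥ (H *ᵥ y) = x ⬝ᵥ (Hᵀ * H) *ᵥ y := fun x y => by
    rw [dotProduct_mulVec, vecMul_mulVec, ← dotProduct_mulVec]
  -- This is |H (v_i - a)|² ≤ 1 expanded; the cross term disappears on averaging because Σ c_i v_i =
  -- 0.
  have key : ∀ i, v i ⬝ᵥ (Hᵀ * H) *ᵥ v i - 2 * (v i ⬝ᵥ (Hᵀ * H) *ᵥ a)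
      + (H *ᵥ a) ⬝ᵥ (H *ᵥ a) ≤ 1 := fun i => by
    obtain ⟨y, hy, hvy⟩ := hout i
    have : y = H *ᵥ v i - H *ᵥ a := by
      rw [← mulVec_sub, hvy, add_sub_cancel_left, mulVec_mulVec, hH, nonsing_inv_mul _ hu,
        one_mulVec]
    rw [this, sub_dotProduct, dotProduct_sub, dotProduct_sub,
      dotProduct_comm (H *ᵥ a) (H *ᵥ v i), hdot, hdot] at hy
    linarith
  have hcR : (∑ i, c i) * R ^ 2 = k := by
    have h := sum_dotProduct_mulVec_eq_trace h2 1
    simp only [one_mulVec, hv, trace_one, Fintype.card_fin] at h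
    rw [Finset.sum_mul, h]
  have hsum : (Hᵀ * H).trace + (∑ i, c i) * ((H *ᵥ a) ⬝ᵥ (H *ᵥ a)) ≤ ∑ i, c i := by
    calc _ = ∑ i, c i * (v i ⬝ᵥ (Hᵀ * H) *ᵥ v i - 2 * (v i ⬝ᵥ (Hᵀ * H) *ᵥ a)
            + (H *ᵥ a) ⬝ᵥ (H *ᵥ a)) := by
          have h0 := sum_mul_dotProduct_eq_zero h1 ((Hᵀ * H) *ᵥ a)
          simp only [mul_add, mul_sub, Finset.sum_add_distrib, Finset.sum_sub_distrib]
          simp only [mul_left_comm (c _) 2, ← Finset.mul_sum, ← Finset.sum_mul, h0,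
            sum_dotProduct_mulVec_eq_trace h2]
          ring
      _ ≤ ∑ i, c i * 1 := Finset.sum_le_sum fun i _ => mul_le_mul_of_nonneg_left (key i) (hc i)
      _ = _ := by simp
  have haa : 0 ≤ (H *ᵥ a) ⬝ᵥ (H *ᵥ a) := Finset.sum_nonneg fun i _ => mul_self_nonneg _
  have hPSD : (Hᵀ * H).PosSemidef := by simpa using posSemidef_conjTranspose_mul_self H
  have hR2 : 0 < R ^ 2 := by positivity
  have hone : R ^ 2 • (Hᵀ * H) = 1 := by
    refine (hPSD.smul hR2.le).eq_one_of_trace_le_of_one_le_det ?_ ?_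
    · rw [trace_smul, smul_eq_mul, Fintype.card_fin, ← hcR, mul_comm]
      exact mul_le_mul_of_nonneg_right (by nlinarith) hR2.le
    · rw [det_smul, Fintype.card_fin, det_mul, det_transpose, hH, det_nonsing_inv,
        Ring.inverse_eq_inv', ← pow_mul, mul_comm 2 k, pow_mul, ← mul_inv, ← div_eq_mul_inv,
        one_le_div (mul_self_pos.2 hG), ← abs_mul_abs_self, ← sq]
      exact pow_le_pow_left₀ (abs_nonneg _) hdet 2
  have hHH : Hᵀ * H = (R ^ 2)⁻¹ • 1 := by
    rw [← hone, smul_smul, inv_mul_cancel₀ hR2.ne', one_smul]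
  constructor
  -- The trace of Hᵀ * H is now exactly Σ c_i, which leaves no room in `hsum` for the centre term.
  · have hz : (H *ᵥ a) ⬝ᵥ (H *ᵥ a) ≤ 0 := by
      rw [hHH, trace_smul, trace_one, Fintype.card_fin, smul_eq_mul, ← hcR, mul_comm _ (R ^ 2),
        inv_mul_cancel_left₀ hR2.ne'] at hsum
      exact nonpos_of_mul_nonpos_right (by linarith) hcpos
    have hHa := dotProduct_self_eq_zero.1 (le_antisymm hz haa)
    have : G *ᵥ (H *ᵥ a) = 0 := by rw [hHa, mulVec_zero]
    rwa [mulVec_mulVec, hH, mul_nonsing_inv _ hu, one_mulVec] at this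
  · have hGT : Gᵀ * Hᵀ = 1 := by rw [← transpose_mul, hH, nonsing_inv_mul _ hu, transpose_one]
    calc G * Gᵀ = G * (Gᵀ * (R ^ 2 • (Hᵀ * H))) := by rw [hone, Matrix.mul_one]
      _ = R ^ 2 • (G * (Gᵀ * Hᵀ * H)) := by
          rw [Matrix.mul_smul, Matrix.mul_smul, ← Matrix.mul_assoc Gᵀ]
      _ = R ^ 2 • 1 := by rw [hGT, Matrix.one_mul, hH, mul_nonsing_inv _ hu]

end Design

/-! ### The same criterion for affine images of the Euclidean ball -/

section Ball

variable {k : ℕ}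

theorem EuclideanSpace.mem_closedBall_zero_iff_dotProduct {r : ℝ} (hr : 0 ≤ r)
    (x : EuclideanSpace ℝ (Fin k)) :
    x ∈ Metric.closedBall 0 r ↔ x.ofLp ⬝ᵥ x.ofLp ≤ r ^ 2 := by
  have h : x.ofLp ⬝ᵥ x.ofLp = ‖x‖ ^ 2 := by
    rw [← real_inner_self_eq_norm_sq, EuclideanSpace.inner_eq_star_dotProduct]; simp
  rw [mem_closedBall_zero_iff, h, sq_le_sq₀ (norm_nonneg _) hr]

theorem AffineMap.exists_matrix_repr (f : EuclideanSpace ℝ (Fin k) →ᵃ[ℝ] EuclideanSpace ℝ (Fin k)) :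
    ∃ G : Matrix (Fin k) (Fin k) ℝ, G.det = LinearMap.det f.linear ∧
      ∀ y, (f y).ofLp = (f 0).ofLp + G *ᵥ y.ofLp := by
  let b := (EuclideanSpace.basisFun (Fin k) ℝ).toBasis
  refine ⟨LinearMap.toMatrix b b f.linear, LinearMap.det_toMatrix _ _, fun y => ?_⟩
  have h := LinearMap.toMatrix_mulVec_repr b b f.linear y
  have hy : (b.repr y : Fin k → ℝ) = y.ofLp := by ext i; simp [b]
  have hf : (b.repr (f.linear y) : Fin k → ℝ) = (f.linear y).ofLp := by ext i; simp [b]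
  rw [hy, hf] at h
  rw [h]
  have := congrFun f.decomp y
  simp only [Pi.add_apply] at this
  rw [this, WithLp.ofLp_add, add_comm]

theorem image_closedBall_eq_of_mul_transpose
    {f : EuclideanSpace ℝ (Fin k) →ᵃ[ℝ] EuclideanSpace ℝ (Fin k)} {G : Matrix (Fin k) (Fin k) ℝ}
    (hf : ∀ y, (f y).ofLp = (f 0).ofLp + G *ᵥ y.ofLp) {r : ℝ} (hr : 0 < r)
    (h0 : (f 0).ofLp = 0) (hG : G * Gᵀ = r ^ 2 • 1) :
    f '' Metric.closedBall 0 1 = Metric.closedBall 0 r := by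
  have hr2 : r ^ 2 ≠ 0 := by positivity
  have hG1 : G * ((r ^ 2)⁻¹ • Gᵀ) = 1 := by
    rw [Matrix.mul_smul, hG, smul_smul, inv_mul_cancel₀ hr2, one_smul]
  have hG2 : Gᵀ * G = r ^ 2 • 1 := by
    have := mul_eq_one_comm.1 hG1
    rw [← this, Matrix.smul_mul, smul_smul, mul_inv_cancel₀ hr2, one_smul]
  have hdot : ∀ y, (f y).ofLp ⬝ᵥ (f y).ofLp = r ^ 2 * (y.ofLp ⬝ᵥ y.ofLp) := fun y => by
    rw [hf, h0, zero_add, dotProduct_mulVec, vecMul_mulVec, ← dotProduct_mulVec, hG2, smul_mulVec,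
      one_mulVec, dotProduct_smul, smul_eq_mul]
  have hmem : ∀ y, f y ∈ Metric.closedBall 0 r ↔ y ∈ Metric.closedBall 0 1 := fun y => by
    rw [EuclideanSpace.mem_closedBall_zero_iff_dotProduct hr.le,
      EuclideanSpace.mem_closedBall_zero_iff_dotProduct zero_le_one, hdot, one_pow]
    exact mul_le_iff_le_one_right (by positivity)
  apply Set.Subset.antisymm
  · rintro _ ⟨y, hy, rfl⟩
    exact (hmem y).2 hy
  · intro x hx
    have hfx : f (WithLp.toLp 2 (((r ^ 2)⁻¹ • Gᵀ) *ᵥ x.ofLp)) = x := by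
      apply WithLp.ofLp_injective
      rw [hf, h0, zero_add, mulVec_mulVec, hG1, one_mulVec]
    exact ⟨_, (hmem _).1 (hfx.symm ▸ hx), hfx⟩

theorem AffineMap.det_linear_ne_zero
    {f : EuclideanSpace ℝ (Fin k) →ᵃ[ℝ] EuclideanSpace ℝ (Fin k)} (hf : Function.Injective f) :
    LinearMap.det f.linear ≠ 0 := by
  rw [← isUnit_iff_ne_zero]
  exact LinearMap.isUnit_det _ ((LinearMap.isUnit_iff_ker_eq_bot _).2
    (LinearMap.ker_eq_bot.2 (f.linear_injective_iff.2 hf)))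

variable {ι : Type*} [Fintype ι] {c : ι → ℝ} {v : ι → EuclideanSpace ℝ (Fin k)}

theorem image_closedBall_eq_of_inscribed {R r : ℝ} (hR : 0 < R) (hr : 0 < r) (hc : ∀ i, 0 ≤ c i)
    (h1 : ∀ p, ∑ i, c i * v i p = 0)
    (h2 : ∀ p q, ∑ i, c i * (v i p * v i q) = (1 : Matrix (Fin k) (Fin k) ℝ) p q)
    (hv : ∀ i, ‖v i‖ = R) {f : EuclideanSpace ℝ (Fin k) →ᵃ[ℝ] EuclideanSpace ℝ (Fin k)}
    (hf : Function.Injective f)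
    (hin : ∀ i, ∀ x ∈ f '' Metric.closedBall 0 1, -(r * R) ≤ inner ℝ (v i) x)
    (hdet : r ^ k ≤ |LinearMap.det f.linear|) :
    f '' Metric.closedBall 0 1 = Metric.closedBall 0 r := by
  obtain ⟨G, hGdet, hfG⟩ := f.exists_matrix_repr
  have hv' : ∀ i, (v i).ofLp ⬝ᵥ (v i).ofLp = R ^ 2 := fun i => by
    rw [← hv i, ← real_inner_self_eq_norm_sq, EuclideanSpace.inner_eq_star_dotProduct]; simp
  obtain ⟨ha, hG⟩ := eq_scalar_of_inscribed (v := fun i => (v i).ofLp) hR hr hc h1 h2 hv' G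
    (f 0).ofLp (hGdet ▸ AffineMap.det_linear_ne_zero hf) (fun i y hy => by
      have h := hin i (f (WithLp.toLp 2 y)) (Set.mem_image_of_mem _
        ((EuclideanSpace.mem_closedBall_zero_iff_dotProduct zero_le_one _).2 (by simpa using hy)))
      rw [EuclideanSpace.inner_eq_star_dotProduct, star_trivial, hfG, dotProduct_comm] at h
      exact h) (hGdet ▸ hdet)
  exact image_closedBall_eq_of_mul_transpose hfG hr ha hG

theorem image_closedBall_eq_of_circumscribed {R : ℝ} (hR : 0 < R) (hc : ∀ i, 0 ≤ c i)
    (hcpos : 0 < ∑ i, c i)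
    (h1 : ∀ p, ∑ i, c i * v i p = 0)
    (h2 : ∀ p q, ∑ i, c i * (v i p * v i q) = (1 : Matrix (Fin k) (Fin k) ℝ) p q)
    (hv : ∀ i, ‖v i‖ = R) {f : EuclideanSpace ℝ (Fin k) →ᵃ[ℝ] EuclideanSpace ℝ (Fin k)}
    (hf : Function.Injective f) (hout : ∀ i, v i ∈ f '' Metric.closedBall 0 1)
    (hdet : |LinearMap.det f.linear| ≤ R ^ k) :
    f '' Metric.closedBall 0 1 = Metric.closedBall 0 R := by
  obtain ⟨G, hGdet, hfG⟩ := f.exists_matrix_repr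
  have hv' : ∀ i, (v i).ofLp ⬝ᵥ (v i).ofLp = R ^ 2 := fun i => by
    rw [← hv i, ← real_inner_self_eq_norm_sq, EuclideanSpace.inner_eq_star_dotProduct]; simp
  obtain ⟨ha, hG⟩ := eq_scalar_of_circumscribed (v := fun i => (v i).ofLp) hR hc hcpos h1 h2 hv' G
    (f 0).ofLp (hGdet ▸ AffineMap.det_linear_ne_zero hf) (fun i => by
      obtain ⟨y, hy, hfy⟩ := hout i
      refine ⟨y.ofLp, ?_, by rw [← hfG, hfy]⟩
      simpa using (EuclideanSpace.mem_closedBall_zero_iff_dotProduct zero_le_one _).1 hy)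
    (hGdet ▸ hdet)
  exact image_closedBall_eq_of_mul_transpose hfG hR ha hG

end Ball

/-! ### Factoring one affine map through another -/

section Factor

variable {V W : Type*} [NormedAddCommGroup V] [NormedSpace ℝ V] [AddCommGroup W] [Module ℝ W]

theorem AffineMap.eq_of_eqOn_closedBall {f g : V →ᵃ[ℝ] W} {ε : ℝ} (hε : 0 < ε)
    (h : Set.EqOn f g (Metric.closedBall 0 ε)) : f = g := by
  have h0 : f 0 = g 0 := h (Metric.mem_closedBall_self hε.le)
  have hlin : f.linear = g.linear := by
    ext x
    -- Shrinks x into the ball; the added 1 covers x = 0.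
    set t : ℝ := ε / (‖x‖ + 1) with ht
    have hx : 0 < ‖x‖ + 1 := by positivity
    have htpos : 0 < t := by positivity
    have hm : t • x ∈ Metric.closedBall (0 : V) ε := by
      rw [mem_closedBall_zero_iff, norm_smul, Real.norm_of_nonneg htpos.le, ht, div_mul_eq_mul_div,
        div_le_iff₀ hx]
      nlinarith [norm_nonneg x]
    have := h hm
    rw [congrFun f.decomp, congrFun g.decomp] at this
    simp only [Pi.add_apply, h0, map_smul, add_left_inj] at this
    exact smul_right_injective W htpos.ne' this
  ext x
  rw [congrFun f.decomp, congrFun g.decomp]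
  simp [hlin, h0]

/-- A linear left inverse of `f₂.linear` gives g, and agreement on a ball suffices for affine maps.
Ellipsoids inside an image are thereby pulled back to the chart. -/
theorem AffineMap.exists_comp_of_image_subset_range {f₁ f₂ : V →ᵃ[ℝ] W}
    (h₁ : Function.Injective f₁) (h₂ : Function.Injective f₂) {ε : ℝ} (hε : 0 < ε)
    (h : f₁ '' Metric.closedBall 0 ε ⊆ Set.range f₂) :
    ∃ g : V →ᵃ[ℝ] V, Function.Injective g ∧ f₁ = f₂.comp g := by
  obtain ⟨L, hL⟩ := f₂.linear.exists_leftInverse_of_injective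
    (LinearMap.ker_eq_bot.2 (f₂.linear_injective_iff.2 h₂))
  have hL' : ∀ y, L (f₂ y - f₂ 0) = y := fun y => by
    rw [congrFun f₂.decomp y]
    simpa using LinearMap.congr_fun hL y
  let g : V →ᵃ[ℝ] V := L.toAffineMap.comp (f₁ - AffineMap.const ℝ V (f₂ 0))
  have hg : f₁ = f₂.comp g := by
    refine AffineMap.eq_of_eqOn_closedBall hε fun x hx => ?_
    obtain ⟨y, hy⟩ := h (Set.mem_image_of_mem _ hx)
    have : g x = y := by
      change L (f₁ x - f₂ 0) = y
      rw [← hy, hL']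
    rw [AffineMap.comp_apply, this, hy]
  refine ⟨g, fun x y hxy => h₁ ?_, hg⟩
  rw [DFunLike.congr_fun hg x, DFunLike.congr_fun hg y]
  exact congrArg f₂ hxy

/-- The version for enclosing ellipsoids: an injective affine self-map in finite dimension is
invertible, so the previous factorization can be reversed. -/
theorem AffineMap.exists_comp_of_subset_image [FiniteDimensional ℝ V] {f₁ f₂ : V →ᵃ[ℝ] W}
    (h₁ : Function.Injective f₁) (h₂ : Function.Injective f₂) {ε : ℝ} (hε : 0 < ε)
    (h : f₁ '' Metric.closedBall 0 ε ⊆ Set.range f₂) :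
    ∃ g : V →ᵃ[ℝ] V, Function.Injective g ∧ f₂ = f₁.comp g := by
  obtain ⟨g, hg, hfg⟩ := exists_comp_of_image_subset_range h₁ h₂ hε h
  have hbij : Function.Bijective g := by
    have hlin := g.linear_injective_iff.2 hg
    exact ⟨hg, g.linear_surjective_iff.1 (LinearMap.injective_iff_surjective.1 hlin)⟩
  let e : V ≃ᵃ[ℝ] V := AffineEquiv.ofBijective hbij
  refine ⟨e.symm.toAffineMap, e.symm.injective, ?_⟩
  ext x
  have : e (e.symm x) = x := e.apply_symm_apply x
  rw [hfg]
  change f₂ x = f₂ (e (e.symm x))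
  rw [this]

end Factor

/-! ### Volumes of affine images -/

section Volume

open MeasureTheory

variable {k n : ℕ}

theorem euclideanHausdorffMeasure_image_affineMap
    (f : EuclideanSpace ℝ (Fin k) →ᵃ[ℝ] EuclideanSpace ℝ (Fin n))
    (s : Set (EuclideanSpace ℝ (Fin k))) :
    μHE[k] (f '' s) = ENNReal.ofReal f.linear.normDet * volume s := by
  have h := f.linear.euclideanHausdorffMeasure_image_eq_normDet_mul_volume s
  rw [finrank_euclideanSpace_fin] at h
  rw [← h, ← (IsometryEquiv.vaddConst (f 0)).isometry.euclideanHausdorffMeasure_image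
    (f.linear '' s), Set.image_image]
  congr 2
  ext x
  rw [congrFun f.decomp]
  simp

theorem euclideanHausdorffMeasure_image_comp_closedBall
    (f : EuclideanSpace ℝ (Fin k) →ᵃ[ℝ] EuclideanSpace ℝ (Fin n))
    (g : EuclideanSpace ℝ (Fin k) →ᵃ[ℝ] EuclideanSpace ℝ (Fin k)) :
    μHE[k] (f '' (g '' Metric.closedBall 0 1)) = ENNReal.ofReal f.linear.normDet *
      (ENNReal.ofReal |LinearMap.det g.linear| *
        volume (Metric.closedBall (0 : EuclideanSpace ℝ (Fin k)) 1)) := by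
  rw [euclideanHausdorffMeasure_image_affineMap]
  have h := euclideanHausdorffMeasure_image_affineMap g (Metric.closedBall 0 1)
  rw [EuclideanSpace.euclideanHausdorffMeasure_eq_volume, LinearMap.normDet_eq_abs_det] at h
  rw [h]

theorem image_smul_closedBall {r : ℝ} (hr : 0 ≤ r) :
    (r • LinearMap.id : EuclideanSpace ℝ (Fin k) →ₗ[ℝ] EuclideanSpace ℝ (Fin k)).toAffineMap ''
      Metric.closedBall 0 1 = Metric.closedBall 0 r := by
  have := smul_unitClosedBall_of_nonneg (E := EuclideanSpace ℝ (Fin k)) hr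
  rw [← this]
  rfl

/-- The factor `f.linear.normDet` and the volume of the unit ball are positive and finite, so both
cancel. -/
theorem euclideanHausdorffMeasure_image_closedBall_le_iff
    {f : EuclideanSpace ℝ (Fin k) →ᵃ[ℝ] EuclideanSpace ℝ (Fin n)} (hf : Function.Injective f)
    (g₁ g₂ : EuclideanSpace ℝ (Fin k) →ᵃ[ℝ] EuclideanSpace ℝ (Fin k)) :
    μHE[k] (f '' (g₁ '' Metric.closedBall 0 1)) ≤ μHE[k] (f '' (g₂ '' Metric.closedBall 0 1)) ↔
      |LinearMap.det g₁.linear| ≤ |LinearMap.det g₂.linear| := by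
  have hdet : 0 < f.linear.normDet := by
    refine lt_of_le_of_ne f.linear.normDet_nonneg fun h => ?_
    exact LinearMap.normDet_eq_zero_iff_ker_ne_bot.1 h.symm
      (LinearMap.ker_eq_bot.2 (f.linear_injective_iff.2 hf))
  have hB : volume (Metric.closedBall (0 : EuclideanSpace ℝ (Fin k)) 1) ≠ 0 :=
    (Metric.measure_closedBall_pos volume 0 one_pos).ne'
  have hB' : volume (Metric.closedBall (0 : EuclideanSpace ℝ (Fin k)) 1) ≠ ⊤ :=
    measure_closedBall_lt_top.ne
  rw [euclideanHausdorffMeasure_image_comp_closedBall,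
    euclideanHausdorffMeasure_image_comp_closedBall,
    ENNReal.mul_le_mul_iff_right (ENNReal.ofReal_pos.2 hdet).ne' ENNReal.ofReal_ne_top,
    ENNReal.mul_le_mul_iff_left hB hB', ENNReal.ofReal_le_ofReal_iff (abs_nonneg _)]

end Volume

/-! ### Extremal ellipsoids of an affine image of a body in John position -/

section JohnPosition

variable {ι : Type*} [Fintype ι] {k n : ℕ} {c : ι → ℝ} {v : ι → EuclideanSpace ℝ (Fin k)}
  {f : EuclideanSpace ℝ (Fin k) →ᵃ[ℝ] EuclideanSpace ℝ (Fin n)}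
  {S : Set (EuclideanSpace ℝ (Fin k))}

theorem det_linear_toAffineMap_smul_id (r : ℝ) :
    LinearMap.det (r • LinearMap.id :
      EuclideanSpace ℝ (Fin k) →ₗ[ℝ] EuclideanSpace ℝ (Fin k)).toAffineMap.linear = r ^ k := by
  simp

theorem isEllipsoid_image_closedBall (hf : Function.Injective f) {r : ℝ} (hr : 0 < r) :
    IsEllipsoid k (f '' Metric.closedBall 0 r) := by
  refine ⟨f.comp (r • LinearMap.id :
    EuclideanSpace ℝ (Fin k) →ₗ[ℝ] EuclideanSpace ℝ (Fin k)).toAffineMap, ?_, ?_⟩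
  · exact hf.comp (smul_right_injective _ hr.ne')
  · rw [AffineMap.coe_comp, Set.image_comp, image_smul_closedBall hr.le]

/-- The half-spaces in `hS` touch the ball at -(r/R) v_i. A competitor of at least the ball's volume
must be the ball, which yields maximality and uniqueness together. -/
theorem isMaxVolumeEllipsoidIn_image_closedBall (hf : Function.Injective f) {R r : ℝ} (hR : 0 < R)
    (hr : 0 < r) (hc : ∀ i, 0 ≤ c i) (h1 : ∀ p, ∑ i, c i * v i p = 0)
    (h2 : ∀ p q, ∑ i, c i * (v i p * v i q) = (1 : Matrix (Fin k) (Fin k) ℝ) p q)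
    (hv : ∀ i, ‖v i‖ = R) (hball : Metric.closedBall 0 r ⊆ S)
    (hS : ∀ x ∈ S, ∀ i, -(r * R) ≤ inner ℝ (v i) x) :
    IsMaxVolumeEllipsoidIn k (f '' Metric.closedBall 0 r) (f '' S) := by
  have key : ∀ F, IsEllipsoid k F → F ⊆ f '' S →
      ∃ g : EuclideanSpace ℝ (Fin k) →ᵃ[ℝ] EuclideanSpace ℝ (Fin k),
        F = f '' (g '' Metric.closedBall 0 1) ∧
          (r ^ k ≤ |LinearMap.det g.linear| → g '' Metric.closedBall 0 1 =
            Metric.closedBall 0 r) := by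
    rintro F ⟨e, he, rfl⟩ hF
    obtain ⟨g, hg, rfl⟩ := AffineMap.exists_comp_of_image_subset_range he hf one_pos
      (hF.trans (Set.image_subset_range f S))
    rw [AffineMap.coe_comp, Set.image_comp] at hF ⊢
    have hgS := (Set.image_subset_image_iff hf).1 hF
    exact ⟨g, rfl, fun h => image_closedBall_eq_of_inscribed hR hr hc h1 h2 hv hg
      (fun i x hx => hS x (hgS hx) i) h⟩
  refine ⟨isEllipsoid_image_closedBall hf hr, Set.image_mono hball, fun F hF hFS => ?_⟩
  obtain ⟨g, rfl, hg⟩ := key F hF hFS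
  have hle : μHE[k] (f '' Metric.closedBall 0 r) ≤ μHE[k] (f '' (g '' Metric.closedBall 0 1)) →
      g '' Metric.closedBall 0 1 = Metric.closedBall 0 r := by
    rw [← image_smul_closedBall hr.le, euclideanHausdorffMeasure_image_closedBall_le_iff hf,
      det_linear_toAffineMap_smul_id, abs_of_pos (pow_pos hr k), image_smul_closedBall hr.le]
    exact hg
  constructor
  · rcases le_total (μHE[k] (f '' (g '' Metric.closedBall 0 1)))
      (μHE[k] (f '' Metric.closedBall 0 r)) with h | h
    · exact h
    · rw [hle h]
  · intro h
    rw [hle h.ge]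

/-- The inner ball serves only to make `S` full-dimensional, so that an enclosing ellipsoid spans
the range of `f` and can be pulled back. -/
theorem isMinVolumeEllipsoidOver_image_closedBall (hf : Function.Injective f) {R r : ℝ}
    (hR : 0 < R) (hr : 0 < r) (hc : ∀ i, 0 ≤ c i) (hcpos : 0 < ∑ i, c i)
    (h1 : ∀ p, ∑ i, c i * v i p = 0)
    (h2 : ∀ p q, ∑ i, c i * (v i p * v i q) = (1 : Matrix (Fin k) (Fin k) ℝ) p q)
    (hv : ∀ i, ‖v i‖ = R) (hball : Metric.closedBall 0 r ⊆ S) (hvS : ∀ i, v i ∈ S)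
    (hS : S ⊆ Metric.closedBall 0 R) :
    IsMinVolumeEllipsoidOver k (f '' Metric.closedBall 0 R) (f '' S) := by
  refine ⟨isEllipsoid_image_closedBall hf hR, Set.image_mono hS, ?_⟩
  rintro F ⟨e, he, rfl⟩ hF
  obtain ⟨g, hg, rfl⟩ := AffineMap.exists_comp_of_subset_image hf he hr
    ((Set.image_mono hball).trans (hF.trans (Set.image_subset_range e _)))
  rw [AffineMap.coe_comp, Set.image_comp] at hF ⊢
  have hgS := (Set.image_subset_image_iff hf).1 hF
  have hle : μHE[k] (f '' (g '' Metric.closedBall 0 1)) ≤ μHE[k] (f '' Metric.closedBall 0 R) →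
      g '' Metric.closedBall 0 1 = Metric.closedBall 0 R := by
    rw [← image_smul_closedBall hR.le, euclideanHausdorffMeasure_image_closedBall_le_iff hf,
      det_linear_toAffineMap_smul_id, abs_of_pos (pow_pos hR k), image_smul_closedBall hR.le]
    exact image_closedBall_eq_of_circumscribed hR hc hcpos h1 h2 hv hg fun i => hgS (hvS i)
  constructor
  · rcases le_total (μHE[k] (f '' Metric.closedBall 0 R))
      (μHE[k] (f '' (g '' Metric.closedBall 0 1))) with h | h
    · exact h
    · rw [hle h]
  · intro h
    rw [hle h.le]

end JohnPosition

/-! ### Orthonormal coordinates on Hermitian matrices -/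

section HermitianCoordinates

variable {d : ℕ}

/-- An isometric real-linear parametrization of the Hermitian matrices. -/
def hermitianOfReal (d : ℕ) :
    EuclideanSpace ℝ (Fin d × Fin d) →ₗ[ℝ] Matrix (Fin d) (Fin d) ℂ where
  -- The entries at (a, b) and (b, a) have squared moduli summing to x(a,b)² + x(b,a)², hence the
  -- isometry; real plus imaginary part recovers x(a,b).
  toFun x := of fun a b => ⟨(x (a, b) + x (b, a)) / 2, (x (a, b) - x (b, a)) / 2⟩
  map_add' x y := by
    ext a b
    apply Complex.ext <;> simp <;> ring
  map_smul' r x := by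
    ext a b
    apply Complex.ext <;> simp <;> ring

theorem hermitianOfReal_isHermitian (x : EuclideanSpace ℝ (Fin d × Fin d)) :
    (hermitianOfReal d x).IsHermitian := by
  ext a b
  apply Complex.ext <;> simp [hermitianOfReal, conjTranspose] <;> ring

theorem re_trace_hermitianOfReal_mul (x y : EuclideanSpace ℝ (Fin d × Fin d)) :
    (hermitianOfReal d x * hermitianOfReal d y).trace.re = inner ℝ x y := by
  have h1 : (hermitianOfReal d x * hermitianOfReal d y).trace.re =
      ∑ a, ∑ b, (x (a, b) * y (a, b) / 2 + x (b, a) * y (b, a) / 2) := by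
    simp only [trace, diag, Matrix.mul_apply, Complex.re_sum, Complex.mul_re, hermitianOfReal,
      LinearMap.coe_mk, AddHom.coe_mk, of_apply]
    exact Finset.sum_congr rfl fun a _ => Finset.sum_congr rfl fun b _ => by ring
  have h2 : inner ℝ x y = ∑ a, ∑ b, x (a, b) * y (a, b) := by
    rw [PiLp.inner_apply, Fintype.sum_prod_type]
    simp [mul_comm]
  rw [h1, h2]
  simp only [Finset.sum_add_distrib]
  rw [Finset.sum_comm (f := fun a b => x (b, a) * y (b, a) / 2), ← two_mul]
  simp only [← Finset.sum_div]
  ring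

theorem exists_hermitianOfReal_eq {X : Matrix (Fin d) (Fin d) ℂ} (hX : X.IsHermitian) :
    ∃ x, hermitianOfReal d x = X := by
  refine ⟨WithLp.toLp 2 fun p => (X p.1 p.2).re + (X p.1 p.2).im, ?_⟩
  ext a b
  have h := hX.apply a b
  have hre := congrArg Complex.re h
  have him := congrArg Complex.im h
  simp only [Complex.star_def, Complex.conj_re, Complex.conj_im] at hre him
  apply Complex.ext <;> simp [hermitianOfReal] <;> linarith

theorem trace_hermitianOfReal (x : EuclideanSpace ℝ (Fin d × Fin d)) :
    (hermitianOfReal d x).trace =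
      ((inner ℝ (WithLp.toLp 2 fun p => if p.1 = p.2 then 1 else 0) x : ℝ) : ℂ) := by
  rw [PiLp.inner_apply, Fintype.sum_prod_type]
  simp only [trace, diag]
  push_cast
  refine Finset.sum_congr rfl fun a _ => ?_
  apply Complex.ext <;> simp [hermitianOfReal]

/-- Orthonormal coordinates on the traceless Hermitian matrices. -/
structure IsTracelessChart {k : ℕ}
    (J : EuclideanSpace ℝ (Fin k) →ₗ[ℝ] Matrix (Fin d) (Fin d) ℂ) : Prop where
  isHermitian : ∀ x, (J x).IsHermitian
  trace_eq_zero : ∀ x, (J x).trace = 0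
  surjective : ∀ X : Matrix (Fin d) (Fin d) ℂ, X.IsHermitian → X.trace = 0 → ∃ x, J x = X
  re_trace_mul : ∀ x y, (J x * J y).trace.re = inner ℝ x y

theorem exists_coord_traceless_hermitian (hd : 1 ≤ d) :
    ∃ J : EuclideanSpace ℝ (Fin (d ^ 2 - 1)) →ₗ[ℝ] Matrix (Fin d) (Fin d) ℂ,
      IsTracelessChart J := by
  -- The coordinates of the identity matrix: pairing with `δ` is the trace, so traceless means
  -- orthogonal to `δ`.
  let δ : EuclideanSpace ℝ (Fin d × Fin d) := WithLp.toLp 2 fun p => if p.1 = p.2 then 1 else 0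
  have hδ : δ ≠ 0 := fun h => by
    have := congrArg (fun x : EuclideanSpace ℝ (Fin d × Fin d) => x (⟨0, hd⟩, ⟨0, hd⟩)) h
    simp [δ] at this
  have hfin : Module.finrank ℝ (EuclideanSpace ℝ (Fin d × Fin d)) = d ^ 2 - 1 + 1 := by
    rw [finrank_euclideanSpace, Fintype.card_prod, Fintype.card_fin, ← sq,
      Nat.sub_add_cancel (Nat.one_le_pow _ _ hd)]
  have : Fact (Module.finrank ℝ (EuclideanSpace ℝ (Fin d × Fin d)) = d ^ 2 - 1 + 1) := ⟨hfin⟩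
  have hV : Module.finrank ℝ (ℝ ∙ δ)ᗮ = d ^ 2 - 1 := Submodule.finrank_orthogonal_span_singleton hδ
  let b := (stdOrthonormalBasis ℝ (ℝ ∙ δ)ᗮ).reindex (finCongr hV)
  refine ⟨hermitianOfReal d ∘ₗ (ℝ ∙ δ)ᗮ.subtype ∘ₗ b.repr.symm.toLinearEquiv.toLinearMap,
    fun x => hermitianOfReal_isHermitian _, fun x => ?_, fun X hX htr => ?_, fun x y => ?_⟩
  · have h := Submodule.mem_orthogonal_singleton_iff_inner_right.1 (b.repr.symm x).2
    simp only [LinearMap.comp_apply, Submodule.subtype_apply]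
    rw [trace_hermitianOfReal, Complex.ofReal_eq_zero]
    exact h
  · obtain ⟨y, rfl⟩ := exists_hermitianOfReal_eq hX
    rw [trace_hermitianOfReal, Complex.ofReal_eq_zero] at htr
    refine ⟨b.repr ⟨y, Submodule.mem_orthogonal_singleton_iff_inner_right.2 htr⟩, ?_⟩
    simp
  · simp only [LinearMap.comp_apply, Submodule.subtype_apply]
    rw [re_trace_hermitianOfReal_mul, ← Submodule.coe_inner]
    exact b.repr.symm.inner_map_map x y

end HermitianCoordinates

/-! ### A weighted projective 2-design from cubic phases -/

section Design

variable {d : ℕ}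

instance fintypeRootsOfUnityThree : Fintype (rootsOfUnity 3 ℂ) := Fintype.ofFinite _

/-- Multiplying one coordinate of w by a primitive cube root permutes the sum and scales it by a
phase. Unless the indices pair up, some coordinate gives a phase other than 1, so the sum vanishes.
-/
theorem sum_rootsOfUnity_phases (a b c e : Fin d) :
    ∑ w : Fin d → rootsOfUnity 3 ℂ,
      (star ((w a : ℂˣ) : ℂ) * ((w b : ℂˣ) : ℂ) * (star ((w c : ℂˣ) : ℂ) * ((w e : ℂˣ) : ℂ))) =
      if (a = b ∧ c = e) ∨ (a = e ∧ b = c) then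
        (Fintype.card (Fin d → rootsOfUnity 3 ℂ) : ℂ) else 0 := by
  have hone : ∀ z : rootsOfUnity 3 ℂ, star ((z : ℂˣ) : ℂ) * ((z : ℂˣ) : ℂ) = 1 := fun z => by
    have hz : ((z : ℂˣ) : ℂ) ^ 3 = 1 := by
      have := (mem_rootsOfUnity' 3 (z : ℂˣ)).1 z.2
      exact this
    have hn := Complex.norm_eq_one_of_pow_eq_one hz (by norm_num)
    rw [Complex.star_def, mul_comm, Complex.mul_conj, Complex.normSq_eq_norm_sq, hn]
    simp
  split_ifs with h
  · rw [Finset.sum_congr rfl fun w _ => (?_ : _ = (1 : ℂ))]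
    · simp
    · rcases h with ⟨rfl, rfl⟩ | ⟨rfl, rfl⟩
      · rw [hone, hone, one_mul]
      · linear_combination (star ((w b : ℂˣ) : ℂ) * ((w b : ℂˣ) : ℂ)) * hone (w a) + hone (w b)
  · obtain ⟨z, hz⟩ : ∃ z : rootsOfUnity 3 ℂ, IsPrimitiveRoot ((z : ℂˣ) : ℂ) 3 := by
      have hp := Complex.isPrimitiveRoot_exp 3 (by norm_num)
      exact ⟨hp.toRootsOfUnity, hp⟩
    have hz1 : ((z : ℂˣ) : ℂ) ≠ 1 := hz.ne_one (by norm_num)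
    have hz2 : ((z : ℂˣ) : ℂ) * ((z : ℂˣ) : ℂ) ≠ 1 := by
      rw [← sq]; exact hz.pow_ne_one_of_pos_of_lt (by norm_num) (by norm_num)
    have hs1 : star ((z : ℂˣ) : ℂ) ≠ 1 := fun h => hz1 (by simpa using congrArg star h)
    have hs2 : star ((z : ℂˣ) : ℂ) * star ((z : ℂˣ) : ℂ) ≠ 1 := fun h =>
      hz2 (by simpa using congrArg star h)
    let s : Fin d → Fin d → ℂ := fun j i => if i = j then ((z : ℂˣ) : ℂ) else 1
    have hss : ∀ j i, star (s j i) * s j i = 1 := fun j i => by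
      by_cases hij : i = j
      · simp only [s, hij, if_true]; exact hone z
      · simp [s, hij]
    have hex : ∃ j, star (s j a) * s j b * (star (s j c) * s j e) ≠ 1 := by
      by_cases hab : a = b
      · have hce : c ≠ e := fun hce => h (Or.inl ⟨hab, hce⟩)
        refine ⟨c, ?_⟩
        rw [← hab, hss, one_mul]
        simpa [s, hce.symm] using hs1
      · by_cases hae : a = e
        · have hbc : b ≠ c := fun hbc => h (Or.inr ⟨hae, hbc⟩)
          refine ⟨c, ?_⟩
          have : star (s c a) * s c b * (star (s c c) * s c e) = s c b * star (s c c) := by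
            rw [← hae]; linear_combination (s c b * star (s c c)) * hss c a
          rw [this]
          simpa [s, hbc] using hs1
        · refine ⟨a, ?_⟩
          -- For c = a the phase is the square of the conjugate root; signs ±1 would fail here,
          -- order three does not.
          by_cases hca : c = a
          · simpa [s, Ne.symm hab, Ne.symm hae, hca] using hs2
          · simpa [s, Ne.symm hab, Ne.symm hae, hca] using hs1
    obtain ⟨j, hj⟩ := hex
    set T := ∑ w : Fin d → rootsOfUnity 3 ℂ,
      (star ((w a : ℂˣ) : ℂ) * ((w b : ℂˣ) : ℂ) * (star ((w c : ℂˣ) : ℂ) * ((w e : ℂˣ) : ℂ)))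
      with hT
    have hshift : (star (s j a) * s j b * (star (s j c) * s j e)) * T = T := by
      rw [hT, Finset.mul_sum]
      refine Fintype.sum_equiv (Equiv.mulLeft (fun i => if i = j then z else 1)) _ _ fun w => ?_
      have hw : ∀ i, ((((fun i => if i = j then z else 1) * w : Fin d → rootsOfUnity 3 ℂ) i :
          ℂˣ) : ℂ) = s j i * ((w i : ℂˣ) : ℂ) := fun i => by
        by_cases hij : i = j <;> simp [s, hij]
      simp only [Equiv.coe_mulLeft, hw, star_mul']
      ring
    have : (star (s j a) * s j b * (star (s j c) * s j e) - 1) * T = 0 := by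
      rw [sub_mul, one_mul, hshift, sub_self]
    exact (mul_eq_zero.1 this).resolve_left (sub_ne_zero.2 hj)

theorem trace_vecMulVec_star_mul (w : Fin d → ℂ) (X : Matrix (Fin d) (Fin d) ℂ) :
    (vecMulVec w (star w) * X).trace = ∑ a, ∑ b, star (w a) * w b * X a b := by
  rw [vecMulVec_mul, trace_vecMulVec, dotProduct]
  simp only [vecMul, dotProduct, Finset.mul_sum, Pi.star_apply]
  rw [Finset.sum_comm]
  exact Finset.sum_congr rfl fun a _ => Finset.sum_congr rfl fun b _ => by ring

/-- The second moments of the vectors with cubic root of unity entries. -/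
theorem sum_phases_trace_mul_trace (X Y : Matrix (Fin d) (Fin d) ℂ) :
    ∑ w : Fin d → rootsOfUnity 3 ℂ,
      (vecMulVec (fun i => ((w i : ℂˣ) : ℂ)) (star fun i => ((w i : ℂˣ) : ℂ)) * X).trace *
      (vecMulVec (fun i => ((w i : ℂˣ) : ℂ)) (star fun i => ((w i : ℂˣ) : ℂ)) * Y).trace =
    (Fintype.card (Fin d → rootsOfUnity 3 ℂ) : ℂ) *
      (X.trace * Y.trace + (X * Y).trace - ∑ a, X a a * Y a a) := by
  -- Inclusion–exclusion: both pairings hold exactly when all four indices agree.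
  have h1 : ∀ a b c e : Fin d, (if (a = b ∧ c = e) ∨ (a = e ∧ b = c) then
        (Fintype.card (Fin d → rootsOfUnity 3 ℂ) : ℂ) else 0) =
      (Fintype.card (Fin d → rootsOfUnity 3 ℂ) : ℂ) * ((if a = b then if c = e then 1 else 0 else 0)
        + (if a = e then if b = c then 1 else 0 else 0)
        - (if a = b then if b = c then if c = e then 1 else 0 else 0 else 0)) := by
    intro a b c e
    by_cases hab : a = b <;> by_cases hce : c = e <;> by_cases hae : a = e <;>
      by_cases hbc : b = c <;> simp_all
  calc _ = ∑ w : Fin d → rootsOfUnity 3 ℂ, ∑ a, ∑ b, ∑ c, ∑ e, (X a b * Y c e) *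
        (star ((w a : ℂˣ) : ℂ) * ((w b : ℂˣ) : ℂ) *
          (star ((w c : ℂˣ) : ℂ) * ((w e : ℂˣ) : ℂ))) := by
        refine Finset.sum_congr rfl fun w _ => ?_
        rw [trace_vecMulVec_star_mul, trace_vecMulVec_star_mul, Finset.sum_mul]
        refine Finset.sum_congr rfl fun a _ => ?_
        rw [Finset.sum_mul]
        refine Finset.sum_congr rfl fun b _ => ?_
        rw [Finset.mul_sum]
        refine Finset.sum_congr rfl fun c _ => ?_
        rw [Finset.mul_sum]
        exact Finset.sum_congr rfl fun e _ => by ring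
    _ = ∑ a, ∑ b, ∑ c, ∑ e, (X a b * Y c e) *
        (if (a = b ∧ c = e) ∨ (a = e ∧ b = c) then
          (Fintype.card (Fin d → rootsOfUnity 3 ℂ) : ℂ) else 0) := by
        rw [Finset.sum_comm]
        refine Finset.sum_congr rfl fun a _ => ?_
        rw [Finset.sum_comm]
        refine Finset.sum_congr rfl fun b _ => ?_
        rw [Finset.sum_comm]
        refine Finset.sum_congr rfl fun c _ => ?_
        rw [Finset.sum_comm]
        refine Finset.sum_congr rfl fun e _ => ?_
        rw [← Finset.mul_sum, sum_rootsOfUnity_phases]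
    _ = ∑ a, ∑ b, ∑ c, ∑ e, (Fintype.card (Fin d → rootsOfUnity 3 ℂ) : ℂ) *
        ((if a = b then if c = e then X a b * Y c e else 0 else 0)
        + (if a = e then if b = c then X a b * Y c e else 0 else 0)
        - (if a = b then if b = c then if c = e then X a b * Y c e else 0 else 0 else 0)) := by
        refine Finset.sum_congr rfl fun a _ => Finset.sum_congr rfl fun b _ =>
          Finset.sum_congr rfl fun c _ => Finset.sum_congr rfl fun e _ => ?_
        rw [h1, mul_left_comm]
        congr 1
        simp only [mul_sub, mul_add, mul_ite, mul_one, mul_zero]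
    _ = _ := by
        simp only [← Finset.mul_sum, Finset.sum_add_distrib, Finset.sum_sub_distrib]
        congr 1
        have e1 : ∑ a : Fin d, ∑ b, ∑ c, ∑ e,
            (if a = b then if c = e then X a b * Y c e else 0 else 0) = X.trace * Y.trace := by
          simp only [trace, diag, Finset.sum_mul_sum]
          refine Finset.sum_congr rfl fun a _ => ?_
          rw [Finset.sum_eq_single a (fun b _ hb => by simp [hb.symm]) (by simp)]
          simp
        have e2 : ∑ a : Fin d, ∑ b, ∑ c, ∑ e,
            (if a = e then if b = c then X a b * Y c e else 0 else 0) = (X * Y).trace := by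
          simp [trace, Matrix.mul_apply]
        have e3 : ∑ a : Fin d, ∑ b, ∑ c, ∑ e,
            (if a = b then if b = c then if c = e then X a b * Y c e else 0 else 0 else 0) =
            ∑ a, X a a * Y a a := by
          refine Finset.sum_congr rfl fun a _ => ?_
          rw [Finset.sum_eq_single a (fun b _ hb => by simp [hb.symm]) (by simp),
            Finset.sum_eq_single a (fun b _ hb => by simp [hb.symm]) (by simp)]
          simp
        rw [e1, e2, e3]

theorem vecMulVec_star_mem_quantumStates {w : Fin d → ℂ} (hw : star w ⬝ᵥ w = 1) :
    vecMulVec w (star w) ∈ quantumStates d ∧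
      vecMulVec w (star w) * vecMulVec w (star w) = vecMulVec w (star w) := by
  refine ⟨⟨posSemidef_vecMulVec_self_star w, ?_⟩, ?_⟩
  · rw [trace_vecMulVec, dotProduct_comm, hw]
  · rw [vecMulVec_mul_vecMulVec, hw, one_smul]

/-- Every dimension admits a finite weighted complex projective 2-design. -/
theorem exists_weighted_two_design (hd : 1 ≤ d) :
    ∃ (ι : Type) (_ : Fintype ι) (c : ι → ℝ) (P : ι → Matrix (Fin d) (Fin d) ℂ),
      (∀ i, 0 ≤ c i) ∧ (∀ i, P i ∈ quantumStates d) ∧ (∀ i, P i * P i = P i) ∧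
      ∀ X Y : Matrix (Fin d) (Fin d) ℂ,
        ∑ i, (c i : ℂ) * ((P i * X).trace * (P i * Y).trace) = X.trace * Y.trace + (X * Y).trace := by
  have hd0 : (d : ℂ) ≠ 0 := by exact_mod_cast (by omega : d ≠ 0)
  set N := Fintype.card (Fin d → rootsOfUnity 3 ℂ) with hN
  have hN0 : (N : ℂ) ≠ 0 := by exact_mod_cast Fintype.card_ne_zero
  let φ : (Fin d → rootsOfUnity 3 ℂ) → Fin d → ℂ := fun w i => ((w i : ℂˣ) : ℂ)
  -- The standard basis restores the diagonal term Σ X_aa Y_aa that the phase vectors miss.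
  let ψ : Fin d ⊕ (Fin d → rootsOfUnity 3 ℂ) → Fin d → ℂ :=
    Sum.elim (fun j => Pi.single j 1) fun w => ((√(d : ℝ))⁻¹ : ℝ) • φ w
  have hψ : ∀ i, star (ψ i) ⬝ᵥ ψ i = 1 := by
    rintro (j | w)
    · simp [ψ]
    · have h1 : ∀ i, star (φ w i) * φ w i = 1 := fun i => by
        have hz : ((w i : ℂˣ) : ℂ) ^ 3 = 1 := (mem_rootsOfUnity' 3 (w i : ℂˣ)).1 (w i).2
        have hn := Complex.norm_eq_one_of_pow_eq_one hz (by norm_num)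
        rw [Complex.star_def, mul_comm, Complex.mul_conj, Complex.normSq_eq_norm_sq, hn]
        simp
      have h2 : star (φ w) ⬝ᵥ φ w = d := by
        simp only [dotProduct, Pi.star_apply, h1]
        simp
      have h3 : (√(d : ℝ))⁻¹ * (√(d : ℝ))⁻¹ = (d : ℝ)⁻¹ := by
        rw [← mul_inv, Real.mul_self_sqrt (Nat.cast_nonneg d)]
      simp only [ψ, Sum.elim_inr, star_smul, smul_dotProduct, dotProduct_smul, h2, smul_smul,
        star_trivial, h3]
      simp [hd0]
  have hφ : ∀ w, vecMulVec (ψ (Sum.inr w)) (star (ψ (Sum.inr w))) =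
      (d : ℂ)⁻¹ • vecMulVec (φ w) (star (φ w)) := fun w => by
    have h3 : (√(d : ℝ))⁻¹ * (√(d : ℝ))⁻¹ = (d : ℝ)⁻¹ := by
      rw [← mul_inv, Real.mul_self_sqrt (Nat.cast_nonneg d)]
    simp only [ψ, Sum.elim_inr, star_smul, smul_vecMulVec, vecMulVec_smul, smul_smul,
      star_trivial, h3]
    ext a b
    simp
  -- The weight d²/N undoes the normalization 1/d of the two projections and averages over the N
  -- phase vectors.
  refine ⟨Fin d ⊕ (Fin d → rootsOfUnity 3 ℂ), inferInstance,
    Sum.elim (fun _ => 1) fun _ => (d : ℝ) ^ 2 / N, fun i => vecMulVec (ψ i) (star (ψ i)), ?_,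
    fun i => (vecMulVec_star_mem_quantumStates (hψ i)).1,
    fun i => (vecMulVec_star_mem_quantumStates (hψ i)).2, fun X Y => ?_⟩
  · rintro (j | w)
    · simp
    · simp only [Sum.elim_inr]; positivity
  · rw [Fintype.sum_sum_type]
    have hl : ∀ (j : Fin d) (Z : Matrix (Fin d) (Fin d) ℂ),
        (vecMulVec (ψ (Sum.inl j)) (star (ψ (Sum.inl j))) * Z).trace = Z j j := fun j Z => by
      rw [trace_vecMulVec_star_mul]
      simp [ψ, Pi.single_apply]
    simp only [hl, hφ, Sum.elim_inl, Sum.elim_inr, Matrix.smul_mul, trace_smul, smul_eq_mul]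
    have h := sum_phases_trace_mul_trace X Y
    calc _ = ∑ j, X j j * Y j j + (N : ℂ)⁻¹ * ∑ w : Fin d → rootsOfUnity 3 ℂ,
          (vecMulVec (φ w) (star (φ w)) * X).trace * (vecMulVec (φ w) (star (φ w)) * Y).trace := by
          congr 1
          · simp
          · rw [Finset.mul_sum]
            refine Finset.sum_congr rfl fun w _ => ?_
            push_cast
            field_simp
      _ = _ := by
          rw [h, ← hN, inv_mul_cancel_left₀ hN0]
          ring

end Design

/-! ### The body of states between two balls -/

section States

variable {d k : ℕ}

/-- By cyclicity the trace is that of the positive semidefinite matrix A B A. -/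
theorem re_trace_mul_nonneg {A B : Matrix (Fin d) (Fin d) ℂ} (hA : A.IsHermitian) (hAA : A * A = A)
    (hB : B.PosSemidef) : 0 ≤ (A * B).trace.re := by
  have h := (hB.mul_mul_conjTranspose_same A).trace_nonneg
  rw [hA.eq, trace_mul_cycle, hAA] at h
  exact (Complex.le_def.1 h).1

theorem im_trace_mul_eq_zero {A B : Matrix (Fin d) (Fin d) ℂ} (hA : A.IsHermitian)
    (hB : B.IsHermitian) : (A * B).trace.im = 0 := by
  have h : star (A * B).trace = (A * B).trace := by
    rw [← trace_conjTranspose, conjTranspose_mul, hA.eq, hB.eq, trace_mul_comm]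
  exact Complex.conj_eq_iff_im.1 h

theorem im_trace_eq_zero {A : Matrix (Fin d) (Fin d) ℂ} (hA : A.IsHermitian) :
    A.trace.im = 0 := by
  simpa using im_trace_mul_eq_zero hA isHermitian_one

theorem purity_le_one {ρ : Matrix (Fin d) (Fin d) ℂ} (hρ : ρ ∈ quantumStates d) :
    (ρ * ρ).trace.re ≤ 1 := by
  obtain ⟨hpsd, htr⟩ := hρ
  have hH := hpsd.isHermitian
  have h1 : ∑ i, hH.eigenvalues i = 1 := by
    have h := hH.trace_eq_sum_eigenvalues
    rw [htr] at h
    have := congrArg Complex.re h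
    simpa using this.symm
  have h2 : (ρ * ρ).trace = ∑ i, ((hH.eigenvalues i : ℂ) * (hH.eigenvalues i : ℂ)) := by
    conv_lhs => rw [hH.spectral_theorem, ← map_mul]
    rw [Unitary.conjStarAlgAut_apply, trace_mul_cycle, Unitary.coe_star_mul_self, Matrix.one_mul,
      diagonal_mul_diagonal, trace_diagonal]
    rfl
  rw [h2, Complex.re_sum, ← one_pow 2, ← h1]
  refine le_trans (le_of_eq ?_)
    (Finset.sum_sq_le_sq_sum_of_nonneg fun i _ => hpsd.eigenvalues_nonneg i)
  exact Finset.sum_congr rfl fun i _ => by simp [sq]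

variable {J : EuclideanSpace ℝ (Fin k) →ₗ[ℝ] Matrix (Fin d) (Fin d) ℂ}

theorem trace_inv_smul_one (hd : 1 ≤ d) :
    ((d : ℝ)⁻¹ • (1 : Matrix (Fin d) (Fin d) ℂ)).trace = 1 := by
  have : (d : ℂ) ≠ 0 := by exact_mod_cast (by omega : d ≠ 0)
  rw [trace_smul, trace_one, Fintype.card_fin, Complex.real_smul]
  push_cast
  exact inv_mul_cancel₀ this

theorem isHermitian_real_smul_one (r : ℝ) :
    (r • (1 : Matrix (Fin d) (Fin d) ℂ)).IsHermitian := by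
  rw [IsHermitian, conjTranspose_smul, conjTranspose_one, star_trivial]

theorem IsTracelessChart.injective (hJ : IsTracelessChart J) : Function.Injective J := by
  rw [injective_iff_map_eq_zero]
  intro x hx
  have h := hJ.re_trace_mul x x
  rw [hx, Matrix.mul_zero, trace_zero, Complex.zero_re] at h
  exact inner_self_eq_zero.1 h.symm

theorem IsTracelessChart.exists_tracelessPart (hJ : IsTracelessChart J) (hd : 1 ≤ d)
    {H : Matrix (Fin d) (Fin d) ℂ} (hH : H.IsHermitian) :
    ∃ y, J y = H - (H.trace.re / d) • 1 ∧ ∀ x, inner ℝ y x = (H * J x).trace.re := by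
  have hd0 : (d : ℂ) ≠ 0 := by exact_mod_cast (by omega : d ≠ 0)
  have htr : H.trace = (H.trace.re : ℂ) := Complex.ext rfl (by simp [im_trace_eq_zero hH])
  obtain ⟨y, hy⟩ := hJ.surjective (H - (H.trace.re / d) • 1)
    (hH.sub (isHermitian_real_smul_one _)) (by
      rw [trace_sub, trace_smul, trace_one, Fintype.card_fin, Complex.real_smul]
      push_cast
      rw [div_mul_cancel₀ _ hd0, ← htr, sub_self])
  refine ⟨y, hy, fun x => ?_⟩
  rw [← hJ.re_trace_mul, hy, Matrix.sub_mul, trace_sub, Matrix.smul_mul, Matrix.one_mul, trace_smul,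
    hJ.trace_eq_zero]
  simp

theorem re_trace_sub_mul_sub (hd : 1 ≤ d) {H K : Matrix (Fin d) (Fin d) ℂ} :
    ((H - (H.trace.re / d) • 1) * (K - (K.trace.re / d) • 1)).trace.re =
      (H * K).trace.re - H.trace.re * K.trace.re / d := by
  have hd0 : (d : ℝ) ≠ 0 := by exact_mod_cast (by omega : d ≠ 0)
  simp only [Matrix.sub_mul, Matrix.mul_sub, Matrix.smul_mul, Matrix.mul_smul, Matrix.one_mul,
    Matrix.mul_one, trace_sub, trace_smul, trace_one, Fintype.card_fin, Complex.sub_re,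
    Complex.smul_re, smul_eq_mul, Complex.natCast_re]
  field_simp
  ring

/-- The states in the chart `x ↦ 1 / d + J x`. -/
def chartStates (J : EuclideanSpace ℝ (Fin k) →ₗ[ℝ] Matrix (Fin d) (Fin d) ℂ) :
    Set (EuclideanSpace ℝ (Fin k)) :=
  {x | (d : ℝ)⁻¹ • 1 + J x ∈ quantumStates d}

theorem chartStates_subset_closedBall (hJ : IsTracelessChart J) (hd : 1 ≤ d) :
    chartStates J ⊆ Metric.closedBall 0 √(((d : ℝ) - 1) / d) := by
  intro x hx
  have hd0 : (0 : ℝ) < d := by exact_mod_cast hd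
  have h := purity_le_one hx
  have e : (((d : ℝ)⁻¹ • 1 + J x) * ((d : ℝ)⁻¹ • 1 + J x)).trace.re = (d : ℝ)⁻¹ + ‖x‖ ^ 2 := by
    rw [← real_inner_self_eq_norm_sq, ← hJ.re_trace_mul]
    simp only [Matrix.add_mul, Matrix.mul_add, Matrix.smul_mul, Matrix.mul_smul, Matrix.one_mul,
      Matrix.mul_one, trace_add, trace_smul, trace_one, Fintype.card_fin, Complex.add_re,
      Complex.smul_re, smul_eq_mul, Complex.natCast_re, hJ.trace_eq_zero, Complex.zero_re]
    field_simp
    ring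
  rw [e] at h
  rw [mem_closedBall_zero_iff]
  apply Real.le_sqrt_of_sq_le
  rw [sub_div, div_self hd0.ne', one_div]
  linarith

/-- For m = ‖w‖², the traceless part of w w* has norm m R, so Cauchy–Schwarz bounds the quadratic
form at w below by m/d - m R ‖x‖, and R ‖x‖ ≤ 1/d. -/
theorem closedBall_subset_chartStates (hJ : IsTracelessChart J) (hd : 2 ≤ d) :
    Metric.closedBall 0 (√(((d : ℝ) - 1) / d) / (d - 1)) ⊆ chartStates J := by
  intro x hx
  have hd0 : (0 : ℝ) < d := by exact_mod_cast (by omega : 0 < d)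
  have hd1 : (0 : ℝ) < (d : ℝ) - 1 := by
    have : (2 : ℝ) ≤ d := by exact_mod_cast hd
    linarith
  have hH := (isHermitian_real_smul_one (d := d) (d : ℝ)⁻¹).add (hJ.isHermitian x)
  refine ⟨PosSemidef.of_dotProduct_mulVec_nonneg hH fun w => ?_, ?_⟩
  · refine Complex.le_def.2 ⟨?_, (hH.im_star_dotProduct_mulVec_self w).symm⟩
    obtain ⟨y, hy, hyx⟩ := hJ.exists_tracelessPart (by omega : 1 ≤ d)
      (posSemidef_vecMulVec_self_star w).isHermitian
    have htrw : (vecMulVec w (star w)).trace.re = ∑ i, ‖w i‖ ^ 2 := by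
      rw [trace_vecMulVec, dotProduct, Complex.re_sum]
      refine Finset.sum_congr rfl fun i _ => ?_
      rw [Pi.star_apply, Complex.star_def, Complex.mul_conj, Complex.ofReal_re,
        Complex.normSq_eq_norm_sq]
    set m := ∑ i, ‖w i‖ ^ 2 with hm
    have hm0 : 0 ≤ m := Finset.sum_nonneg fun i _ => sq_nonneg _
    have hdot : star w ⬝ᵥ w = (m : ℂ) := by
      rw [dotProduct, hm]
      push_cast
      refine Finset.sum_congr rfl fun i _ => ?_
      rw [Pi.star_apply, Complex.star_def, mul_comm, Complex.mul_conj, Complex.normSq_eq_norm_sq]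
      push_cast
      rfl
    have hyn : ‖y‖ ^ 2 = m ^ 2 * (((d : ℝ) - 1) / d) := by
      rw [← real_inner_self_eq_norm_sq, ← hJ.re_trace_mul, hy, re_trace_sub_mul_sub (by omega),
        htrw, vecMulVec_mul_vecMulVec, hdot, vecMulVec_smul, trace_smul, smul_eq_mul,
        Complex.re_ofReal_mul, htrw]
      field_simp
    have hyn' : ‖y‖ = m * √(((d : ℝ) - 1) / d) := by
      rw [← Real.sqrt_sq (norm_nonneg y), hyn, Real.sqrt_mul (sq_nonneg m), Real.sqrt_sq hm0]
    have hx' := mem_closedBall_zero_iff.1 hx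
    have hcs := neg_le_of_abs_le (abs_real_inner_le_norm y x)
    have hval : (star w ⬝ᵥ ((d : ℝ)⁻¹ • 1 + J x) *ᵥ w).re = (d : ℝ)⁻¹ * m + inner ℝ y x := by
      rw [hyx, add_mulVec, dotProduct_add, smul_mulVec, one_mulVec, dotProduct_smul, hdot,
        Complex.add_re, Complex.smul_re, Complex.ofReal_re, smul_eq_mul, vecMulVec_mul,
        trace_vecMulVec, dotProduct_comm w, dotProduct_mulVec]
    have hprod : ‖y‖ * ‖x‖ ≤ (d : ℝ)⁻¹ * m := by
      calc ‖y‖ * ‖x‖ ≤ (m * √(((d : ℝ) - 1) / d)) * (√(((d : ℝ) - 1) / d) / (d - 1)) := by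
            rw [hyn']
            exact mul_le_mul_of_nonneg_left hx' (by positivity)
        _ = m * (√(((d : ℝ) - 1) / d) * √(((d : ℝ) - 1) / d)) / (d - 1) := by ring
        _ = (d : ℝ)⁻¹ * m := by
            rw [Real.mul_self_sqrt (by positivity)]
            field_simp
    rw [Complex.zero_re, hval]
    linarith
  · rw [trace_add, trace_inv_smul_one (by omega), hJ.trace_eq_zero, add_zero]

/-- The v_i are the traceless parts of the design projections. The design identity gives the total
weight at X = Y = 1, the first moments for X traceless and Y = 1, and the second moments for both
traceless. The last bound is Tr[P_i ρ] ≥ 0. -/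
theorem exists_chart_design (hJ : IsTracelessChart J) (hd : 1 ≤ d) :
    ∃ (ι : Type) (_ : Fintype ι) (c : ι → ℝ) (v : ι → EuclideanSpace ℝ (Fin k)),
      (∀ i, 0 ≤ c i) ∧ 0 < ∑ i, c i ∧ (∀ p, ∑ i, c i * v i p = 0) ∧
      (∀ p q, ∑ i, c i * (v i p * v i q) = (1 : Matrix (Fin k) (Fin k) ℝ) p q) ∧
      (∀ i, ‖v i‖ = √(((d : ℝ) - 1) / d)) ∧ (∀ i, v i ∈ chartStates J) ∧
      ∀ x ∈ chartStates J, ∀ i, -(d : ℝ)⁻¹ ≤ inner ℝ (v i) x := by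
  have hd0 : (0 : ℝ) < d := by exact_mod_cast hd
  obtain ⟨ι, _, c, P, hc, hP, hPP, hdes⟩ := exists_weighted_two_design hd
  have hPH : ∀ i, (P i).IsHermitian := fun i => (hP i).1.isHermitian
  choose v hv hvx using fun i => hJ.exists_tracelessPart hd (hPH i)
  have hre : ∀ X Y : Matrix (Fin d) (Fin d) ℂ, X.IsHermitian → Y.IsHermitian →
      ∑ i, c i * ((P i * X).trace.re * (P i * Y).trace.re) =
        X.trace.re * Y.trace.re + (X * Y).trace.re := fun X Y hX hY => by
    have h := congrArg Complex.re (hdes X Y)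
    simp only [Complex.re_sum, Complex.mul_re, Complex.add_re, Complex.ofReal_re,
      Complex.ofReal_im, im_trace_mul_eq_zero (hPH _) hX, im_trace_eq_zero hX, zero_mul, sub_zero] at h
    exact h
  have hPtr : ∀ i, (P i).trace.re = 1 := fun i => by rw [(hP i).2, Complex.one_re]
  have hvp : ∀ i p, v i p = (P i * J (EuclideanSpace.single p 1)).trace.re := fun i p => by
    rw [← hvx, real_inner_comm, EuclideanSpace.inner_single_left]
    simp
  have hJ0 : ∀ x, (J x).trace.re = 0 := fun x => by rw [hJ.trace_eq_zero, Complex.zero_re]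
  refine ⟨ι, inferInstance, c, v, hc, ?_, fun p => ?_, fun p q => ?_, fun i => ?_, fun i => ?_,
    fun x hx i => ?_⟩
  · have h := hre 1 1 isHermitian_one isHermitian_one
    simp only [mul_one, hPtr, trace_one, Fintype.card_fin, Complex.natCast_re] at h
    rw [h]
    positivity
  · have h := hre (J (EuclideanSpace.single p 1)) 1 (hJ.isHermitian _) isHermitian_one
    simp only [mul_one, hPtr, hJ0, zero_mul, add_zero] at h
    simpa only [hvp] using h
  · have h := hre (J (EuclideanSpace.single p 1)) (J (EuclideanSpace.single q 1))
      (hJ.isHermitian _) (hJ.isHermitian _)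
    rw [hJ0, zero_mul, zero_add, hJ.re_trace_mul, EuclideanSpace.inner_single_left] at h
    simp only [hvp, h, one_apply]
    simp
  · have h : ‖v i‖ ^ 2 = ((d : ℝ) - 1) / d := by
      rw [← real_inner_self_eq_norm_sq, ← hJ.re_trace_mul, hv, re_trace_sub_mul_sub hd, hPP, hPtr]
      field_simp
    rw [← h, Real.sqrt_sq (norm_nonneg _)]
  · have : (d : ℝ)⁻¹ • 1 + J (v i) = P i := by
      rw [hv, hPtr, one_div, add_sub_cancel]
    change (d : ℝ)⁻¹ • 1 + J (v i) ∈ quantumStates d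
    rw [this]
    exact hP i
  · have h := re_trace_mul_nonneg (hPH i) (hPP i) hx.1
    rw [Matrix.mul_add, trace_add, Complex.add_re, Matrix.mul_smul, Matrix.mul_one, trace_smul,
      Complex.smul_re, hPtr, smul_eq_mul, mul_one, ← hvx] at h
    linarith

end States

/-! ### The quadratic form of the pseudo-inverse -/

section PseudoInverse

variable {n k : ℕ}

theorem symmPinv_posSemidef {Q : Matrix (Fin n) (Fin n) ℝ} (hQ : Q.PosSemidef) :
    (symmPinv Q).PosSemidef := by
  have hN : (symmPinv Q)ᴴ = symmPinv Q := (cfc_predicate _ Q : IsSelfAdjoint _)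
  have h := hQ.mul_mul_conjTranspose_same (symmPinv Q)
  rwa [hN, (symmPinv_penrose hQ.isHermitian).2.1] at h

theorem norm_psdSqrt_symmPinv_sq {A : Matrix (Fin n) (Fin k) ℝ}
    (hA : Function.Injective A.mulVec) {c : ℝ} (hc : 0 < c) (x : EuclideanSpace ℝ (Fin k)) :
    ‖Matrix.toEuclideanLin (psdSqrt (symmPinv (c • (A * Aᵀ)))) (WithLp.toLp 2 (A *ᵥ x.ofLp))‖ ^ 2 =
      c⁻¹ * ‖x‖ ^ 2 := by
  have hQ : (c • (A * Aᵀ)).PosSemidef := by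
    refine PosSemidef.smul ?_ hc.le
    simpa using posSemidef_self_mul_conjTranspose A
  set N := symmPinv (c • (A * Aᵀ)) with hN
  have hNpsd : N.PosSemidef := symmPinv_posSemidef hQ
  obtain ⟨L, hL⟩ : ∃ L : Matrix (Fin k) (Fin n) ℝ, L * A = 1 := by
    obtain ⟨l, hl⟩ := (Matrix.toLin' A).exists_leftInverse_of_injective (LinearMap.ker_eq_bot.2 hA)
    refine ⟨LinearMap.toMatrix' l, ?_⟩
    have := congrArg LinearMap.toMatrix' hl
    rwa [LinearMap.toMatrix'_comp, LinearMap.toMatrix'_toLin', LinearMap.toMatrix'_id] at this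
  have hL' : Aᵀ * Lᵀ = 1 := by rw [← transpose_mul, hL, transpose_one]
  have hpen : (c • (A * Aᵀ)) * N * (c • (A * Aᵀ)) = c • (A * Aᵀ) :=
    (symmPinv_penrose hQ.isHermitian).1
  -- A left inverse of A strips the outer factors from the Penrose equation Q N Q = Q.
  have hANA : Aᵀ * N * A = c⁻¹ • 1 := by
    have h := congrArg (fun M => L * M * Lᵀ) hpen
    simp only [Matrix.smul_mul, Matrix.mul_smul] at h
    have e1 : L * (A * Aᵀ * N * (A * Aᵀ)) * Lᵀ = Aᵀ * N * A := by
      calc _ = (L * A) * (Aᵀ * N * A) * (Aᵀ * Lᵀ) := by simp only [Matrix.mul_assoc]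
        _ = _ := by rw [hL, hL', Matrix.one_mul, Matrix.mul_one]
    have e2 : L * (A * Aᵀ) * Lᵀ = 1 := by
      calc _ = (L * A) * (Aᵀ * Lᵀ) := by simp only [Matrix.mul_assoc]
        _ = _ := by rw [hL, hL', Matrix.one_mul]
    rw [e1, e2] at h
    have h' := congrArg (fun M => (c⁻¹ * c⁻¹) • M) h
    simp only [smul_smul] at h'
    have ec : c⁻¹ * c⁻¹ * (c * c) = 1 := by field_simp
    have ec' : c⁻¹ * c⁻¹ * c = c⁻¹ := by field_simp
    rwa [ec, ec', one_smul] at h'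
  have hSt : (psdSqrt N)ᵀ = psdSqrt N := by
    simpa [IsHermitian] using psdSqrt_isHermitian N
  have hNt : Nᵀ = N := by simpa [IsHermitian] using hNpsd.isHermitian
  have hx : ‖x‖ ^ 2 = x.ofLp ⬝ᵥ x.ofLp := by
    rw [← real_inner_self_eq_norm_sq, EuclideanSpace.inner_eq_star_dotProduct]; simp
  rw [← real_inner_self_eq_norm_sq, EuclideanSpace.inner_eq_star_dotProduct, Matrix.toLpLin_apply,
    star_trivial, hx]
  simp only
  rw [dotProduct_mulVec, vecMul_mulVec, ← dotProduct_mulVec, hSt, psdSqrt_mul_self hNpsd,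
    mulVec_mulVec, dotProduct_comm, dotProduct_mulVec, vecMul_mulVec, ← dotProduct_mulVec,
    transpose_mul, hNt, hANA, smul_mulVec, one_mulVec, dotProduct_smul, smul_eq_mul]

end PseudoInverse

/-! ### The measurement in coordinates -/

namespace QMeasurement

variable {d n k : ℕ}

/-- The action of a measurement as a real-linear map. -/
def applyLinear (M : QMeasurement d n) :
    Matrix (Fin d) (Fin d) ℂ →ₗ[ℝ] EuclideanSpace ℝ (Fin n) where
  toFun := M.apply
  map_add' X Y := by
    ext i
    simp [apply, Matrix.mul_add]
  map_smul' r X := by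
    ext i
    simp [apply]

theorem apply_inv_smul_one (M : QMeasurement d n) :
    M.apply ((d : ℝ)⁻¹ • 1) = M.center := by
  ext i
  change (M.effect i * (d : ℝ)⁻¹ • 1).trace.re = (M.effect i).trace.re / d
  rw [Matrix.mul_smul, Matrix.mul_one, trace_smul, Complex.smul_re, smul_eq_mul, div_eq_inv_mul]

/-- The outcome distribution in the chart `x ↦ 1 / d + J x`. -/
def chartMap (M : QMeasurement d n)
    (J : EuclideanSpace ℝ (Fin k) →ₗ[ℝ] Matrix (Fin d) (Fin d) ℂ) :
    EuclideanSpace ℝ (Fin k) →ᵃ[ℝ] EuclideanSpace ℝ (Fin n) :=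
  (M.applyLinear ∘ₗ J).toAffineMap + AffineMap.const ℝ _ M.center

variable {M : QMeasurement d n} {J : EuclideanSpace ℝ (Fin k) →ₗ[ℝ] Matrix (Fin d) (Fin d) ℂ}

theorem chartMap_apply (x : EuclideanSpace ℝ (Fin k)) :
    M.chartMap J x = M.apply (J x) + M.center := rfl

theorem chartMap_eq_apply (x : EuclideanSpace ℝ (Fin k)) :
    M.chartMap J x = M.apply ((d : ℝ)⁻¹ • 1 + J x) := by
  rw [chartMap_apply, ← apply_inv_smul_one, add_comm]
  exact (M.applyLinear.map_add _ _).symm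

theorem _root_.IsTracelessChart.exists_eq_of_trace_eq_one (hJ : IsTracelessChart J) (hd : 1 ≤ d)
    {X : Matrix (Fin d) (Fin d) ℂ} (hX : X.IsHermitian) (htr : X.trace = 1) :
    ∃ x, (d : ℝ)⁻¹ • 1 + J x = X := by
  obtain ⟨x, hx⟩ := hJ.surjective (X - (d : ℝ)⁻¹ • 1) (hX.sub (isHermitian_real_smul_one _))
    (by rw [trace_sub, trace_inv_smul_one hd, htr, sub_self])
  exact ⟨x, by rw [hx, add_sub_cancel]⟩

theorem testingRegion_eq_image_chartStates (hJ : IsTracelessChart J) (hd : 1 ≤ d) :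
    M.testingRegion = M.chartMap J '' chartStates J := by
  apply Set.Subset.antisymm
  · rintro _ ⟨ρ, hρ, rfl⟩
    obtain ⟨x, rfl⟩ := hJ.exists_eq_of_trace_eq_one hd hρ.1.isHermitian hρ.2
    exact ⟨x, hρ, chartMap_eq_apply x⟩
  · rintro _ ⟨x, hx, rfl⟩
    exact ⟨_, hx, (chartMap_eq_apply x).symm⟩

/-- Completeness speaks of states only, but they contain a ball about 1/d: a kernel vector scaled
into it gives a state indistinguishable from 1/d. -/
theorem chartMap_injective (hJ : IsTracelessChart J) (hd : 2 ≤ d)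
    (hM : M.InformationallyComplete) : Function.Injective (M.chartMap J) := by
  have hd1 : (0 : ℝ) < (d : ℝ) - 1 := by
    have : (2 : ℝ) ≤ d := by exact_mod_cast hd
    linarith
  have hr : 0 < √(((d : ℝ) - 1) / d) / (d - 1) := by positivity
  rw [← AffineMap.linear_injective_iff, injective_iff_map_eq_zero]
  intro x hx
  have hx' : M.applyLinear (J x) = 0 := by simpa [chartMap] using hx
  set t := (√(((d : ℝ) - 1) / d) / (d - 1)) / (‖x‖ + 1) with ht
  have htpos : 0 < t := by positivity
  have hmem : t • x ∈ chartStates J := by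
    apply closedBall_subset_chartStates hJ hd
    rw [mem_closedBall_zero_iff, norm_smul, Real.norm_of_nonneg htpos.le, ht, div_mul_eq_mul_div,
      div_le_iff₀ (by positivity)]
    nlinarith [norm_nonneg x]
  have hmem0 : (0 : EuclideanSpace ℝ (Fin k)) ∈ chartStates J :=
    closedBall_subset_chartStates hJ hd (Metric.mem_closedBall_self hr.le)
  have h := hM hmem hmem0 (by
    rw [← chartMap_eq_apply, ← chartMap_eq_apply, chartMap_apply, chartMap_apply]
    congr 1
    change M.applyLinear (J (t • x)) = M.applyLinear (J 0)
    rw [map_smul, map_smul, hx', map_zero, map_zero, smul_zero])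
  have h0 := hJ.injective (add_left_cancel h)
  exact (smul_eq_zero.1 h0).resolve_left htpos.ne'

/-- The covariance matrix factors through the chart. -/
theorem exists_matrix_covariance (hJ : IsTracelessChart J) (hd : 1 ≤ d) :
    ∃ A : Matrix (Fin n) (Fin k) ℝ, M.covariance = (((d : ℝ) - 1) / d) • (A * Aᵀ) ∧
      ∀ x, M.apply (J x) = WithLp.toLp 2 (A *ᵥ x.ofLp) := by
  choose a ha hax using fun i => hJ.exists_tracelessPart hd (M.posSemidef i).isHermitian
  -- Row i holds the coordinates of the traceless part of the i-th effect, so A Aᵀ is the Gram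
  -- matrix of these parts.
  refine ⟨of fun i p => a i p, ?_, fun x => ?_⟩
  · ext i j
    have h : ((of fun i p => a i p) * (of fun i p => a i p)ᵀ : Matrix (Fin n) (Fin n) ℝ) i j =
        inner ℝ (a i) (a j) := by
      rw [PiLp.inner_apply]
      simp [Matrix.mul_apply, mul_comm]
    rw [Matrix.smul_apply, h, ← hJ.re_trace_mul, ha, ha, re_trace_sub_mul_sub hd]
    rfl
  · ext i
    change (M.effect i * J x).trace.re = _
    rw [← hax, PiLp.inner_apply]
    simp [mulVec, dotProduct, mul_comm]

theorem ellipsoid_eq_image_closedBall (hJ : IsTracelessChart J) (hd : 2 ≤ d)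
    (hM : M.InformationallyComplete) {r : ℝ} (hr : 0 < r) :
    M.ellipsoid r = M.chartMap J '' Metric.closedBall 0 (√(((d : ℝ) - 1) / d) / r) := by
  have hd0 : (0 : ℝ) < d := by exact_mod_cast (by omega : 0 < d)
  have hd1 : (0 : ℝ) < (d : ℝ) - 1 := by
    have : (2 : ℝ) ≤ d := by exact_mod_cast hd
    linarith
  have hc : 0 < ((d : ℝ) - 1) / d := by positivity
  obtain ⟨A, hcov, hA⟩ := exists_matrix_covariance (M := M) hJ (by omega : 1 ≤ d)
  have hAinj : Function.Injective A.mulVec := fun x y hxy => by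
    have h : M.chartMap J (WithLp.toLp 2 x) = M.chartMap J (WithLp.toLp 2 y) := by
      rw [chartMap_apply, chartMap_apply, hA, hA, hxy]
    exact WithLp.toLp_injective 2 (chartMap_injective hJ hd hM h)
  have hiff : ∀ x, ‖Matrix.toEuclideanLin (psdSqrt (symmPinv M.covariance))
      (M.chartMap J x - M.center)‖ ^ 2 ≤ 1 / r ^ 2 ↔
        x ∈ Metric.closedBall 0 (√(((d : ℝ) - 1) / d) / r) := fun x => by
    rw [chartMap_apply, add_sub_cancel_right, hA, hcov, norm_psdSqrt_symmPinv_sq hAinj hc,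
      mem_closedBall_zero_iff, inv_mul_le_iff₀ hc, ← sq_le_sq₀ (norm_nonneg x) (by positivity),
      div_pow, Real.sq_sqrt hc.le, mul_one_div]
  apply Set.Subset.antisymm
  · rintro _ ⟨⟨X, ⟨hX, htr⟩, rfl⟩, hp⟩
    obtain ⟨x, rfl⟩ := hJ.exists_eq_of_trace_eq_one (by omega) hX htr
    rw [← chartMap_eq_apply] at hp ⊢
    exact ⟨x, (hiff x).1 hp, rfl⟩
  · rintro _ ⟨x, hx, rfl⟩
    refine ⟨⟨_, ⟨(isHermitian_real_smul_one (d := d) (d : ℝ)⁻¹).add (hJ.isHermitian x), ?_⟩,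
      (chartMap_eq_apply x).symm⟩, (hiff x).2 hx⟩
    rw [trace_add, trace_inv_smul_one (by omega), hJ.trace_eq_zero, add_zero]

/-! ### The degenerate case d = 1 -/

theorem eq_one_of_trace_eq_one {X : Matrix (Fin 1) (Fin 1) ℂ} (hX : X.trace = 1) : X = 1 := by
  ext i j
  rw [Subsingleton.elim i 0, Subsingleton.elim j 0, ← trace_fin_one X, hX, one_apply_eq]

theorem testingRegion_of_dim_one (M : QMeasurement 1 n) : M.testingRegion = {M.center} := by
  have hc : M.apply 1 = M.center := by simpa using apply_inv_smul_one M
  have hq : quantumStates 1 = {1} := Set.Subset.antisymm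
    (fun X hX => eq_one_of_trace_eq_one hX.2) (by rintro _ rfl; exact ⟨PosSemidef.one, by simp⟩)
  rw [testingRegion, hq, Set.image_singleton, hc]

theorem ellipsoid_of_dim_one (M : QMeasurement 1 n) (r : ℝ) : M.ellipsoid r = {M.center} := by
  have hc : M.apply 1 = M.center := by simpa using apply_inv_smul_one M
  apply Set.Subset.antisymm
  · rintro _ ⟨⟨X, ⟨_, htr⟩, rfl⟩, _⟩
    rw [eq_one_of_trace_eq_one htr, hc]
    rfl
  · rintro _ rfl
    refine ⟨⟨1, ⟨isHermitian_one, by simp⟩, hc⟩, ?_⟩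
    rw [sub_self, map_zero, norm_zero, zero_pow two_ne_zero]
    -- Only 1 / r² ≥ 0 is needed, which includes r = 0, where the quotient is 0.
    positivity

end QMeasurement

theorem isEllipsoid_zero_iff {n : ℕ} {F : Set (EuclideanSpace ℝ (Fin n))} :
    IsEllipsoid 0 F ↔ ∃ p, F = {p} := by
  have hball : Metric.closedBall (0 : EuclideanSpace ℝ (Fin 0)) 1 = {0} :=
    Set.Subset.antisymm (fun x _ => Subsingleton.elim x 0) (by simp)
  constructor
  · rintro ⟨f, _, rfl⟩
    exact ⟨f 0, by rw [hball, Set.image_singleton]⟩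
  · rintro ⟨p, rfl⟩
    exact ⟨AffineMap.const ℝ _ p, Function.injective_of_subsingleton _, by simp [hball]⟩

theorem isMaxVolumeEllipsoidIn_singleton {n : ℕ} (p : EuclideanSpace ℝ (Fin n)) :
    IsMaxVolumeEllipsoidIn 0 {p} {p} := by
  refine ⟨isEllipsoid_zero_iff.2 ⟨p, rfl⟩, subset_rfl, fun F hF hFp => ?_⟩
  obtain ⟨q, rfl⟩ := isEllipsoid_zero_iff.1 hF
  obtain rfl := Set.singleton_subset_singleton.1 hFp
  exact ⟨le_rfl, fun _ => rfl⟩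

theorem isMinVolumeEllipsoidOver_singleton {n : ℕ} (p : EuclideanSpace ℝ (Fin n)) :
    IsMinVolumeEllipsoidOver 0 {p} {p} := by
  refine ⟨isEllipsoid_zero_iff.2 ⟨p, rfl⟩, subset_rfl, fun F hF hFp => ?_⟩
  obtain ⟨q, rfl⟩ := isEllipsoid_zero_iff.1 hF
  obtain rfl := Set.singleton_subset_singleton.1 hFp
  exact ⟨le_rfl, fun _ => rfl⟩

end

/-! ### Conclusion -/

theorem theorem1 {d n : ℕ} (hd : 1 ≤ d) (M : QMeasurement d n)
    (hM : M.InformationallyComplete) :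
    IsMaxVolumeEllipsoidIn (d ^ 2 - 1) (M.ellipsoid ((d : ℝ) - 1)) M.testingRegion ∧
      IsMinVolumeEllipsoidOver (d ^ 2 - 1) (M.ellipsoid 1) M.testingRegion := by
  obtain rfl | hd2 : d = 1 ∨ 2 ≤ d := by omega
  · rw [M.testingRegion_of_dim_one, M.ellipsoid_of_dim_one, M.ellipsoid_of_dim_one]
    exact ⟨isMaxVolumeEllipsoidIn_singleton _, isMinVolumeEllipsoidOver_singleton _⟩
  have hd0 : (0 : ℝ) < d := by exact_mod_cast hd
  have hd1 : (0 : ℝ) < (d : ℝ) - 1 := by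
    have : (2 : ℝ) ≤ d := by exact_mod_cast hd2
    linarith
  have hR : 0 < √(((d : ℝ) - 1) / d) := by positivity
  have hr : 0 < √(((d : ℝ) - 1) / d) / (d - 1) := by positivity
  obtain ⟨J, hJ⟩ := exists_coord_traceless_hermitian hd
  obtain ⟨ι, _, c, v, hc, hcpos, h1, h2, hv, hvS, hS⟩ := exists_chart_design hJ hd
  have hinj := QMeasurement.chartMap_injective hJ hd2 hM
  have hball := closedBall_subset_chartStates hJ hd2
  rw [QMeasurement.testingRegion_eq_image_chartStates hJ hd,
    QMeasurement.ellipsoid_eq_image_closedBall hJ hd2 hM hd1,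
    QMeasurement.ellipsoid_eq_image_closedBall hJ hd2 hM one_pos, div_one]
  refine ⟨isMaxVolumeEllipsoidIn_image_closedBall hinj hR hr hc h1 h2 hv hball fun x hx i => ?_,
    isMinVolumeEllipsoidOver_image_closedBall hinj hR hr hc hcpos h1 h2 hv hball hvS
      (chartStates_subset_closedBall hJ hd)⟩
  -- The identity rR = 1/d matches the supporting half-spaces of the inner ball with positivity of
  -- Tr[P_i ρ].
  have e : √(((d : ℝ) - 1) / d) / (d - 1) * √(((d : ℝ) - 1) / d) = (d : ℝ)⁻¹ := by
    rw [div_mul_eq_mul_div, Real.mul_self_sqrt (by positivity)]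
    field_simp
  rw [e]
  exact hS x hx i
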